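/- \textbf{Setting.} A \emph{cone} in $\mathbb{R}^n$ is the set of non-negative combinations of finitely many linearly independent vectors; its faces are its intersections with supporting hyperplanes $u^\perp$ ($u=0$ allowed, giving the cone itself). A \emph{fan} $\Sigma$ in $\mathbb{R}^n$ is a set of cones closed under faces in which any two cones meet in a common face. For $\sigma\in\Sigma$ let $\mathrm{star}(\sigma)=\{\tau\in\Sigma:\sigma\subseteq\tau\}$ and let $\pi_\sigma$ be the orthogonal projection onto $\mathrm{span}(\sigma)^\perp$. An \emph{admissible partition} $\mathfrak P$ of $\Sigma$ is an equivalence relation $\sim$ on $\Sigma$ (with classes $[\sigma]$) such that $\sigma_1\sim\sigma_2$ implies $\mathrm{span}(\sigma_1)^\perp=\mathrm{span}(\sigma_2)^\perp$ and $\{\pi_{\sigma_1}(\tau):\tau\in\mathrm{star}(\sigma_1)\}=\{\pi_{\sigma_2}(\tau):\tau\in\mathrm{star}(\sigma_2)\}$, and such that $\sigma_1\sim\sigma_2$, $\tau_i\in\mathrm{star}(\sigma_i)$ and $\pi_{\sigma_1}(\tau_1)=\pi_{\sigma_2}(\tau_2)$ imply $\tau_1\sim\tau_2$. The category $\mathfrak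 C(\Sigma,\mathfrak P)$ has the classes $[\sigma]$ as objects; a morphism $[\sigma]\to[\tau]$ is a class $[f_{\sigma'\tau'}]$ of inclusions $\sigma'\subseteq\tau'$ with $\sigma'\in[\sigma]$, $\tau'\in[\tau]$, where $f_{\sigma_1\tau_1}\sim f_{\sigma_2\tau_2}$ iff $\pi_{\sigma_1}(\tau_1)=\pi_{\sigma_2}(\tau_2)$; composition is $[f_{\kappa\tau}]\circ[f_{\sigma\kappa}]=[f_{\sigma\tau}]$. Its classifying space $\mathcal B\mathfrak C(\Sigma,\mathfrak P)$ is the geometric realisation of its nerve. The \emph{cell} $e([\sigma])$ is the image of the realisation $|\mathrm{star}(\sigma)|$ of the nerve of the poset $\mathrm{star}(\sigma)$ under the map induced by $\tau\mapsto[\tau]$, $(\tau\subseteq\tau')\mapsto[f_{\tau\tau'}]$. A \emph{fan poset} $(\Sigma,\mathcal P)$ is a finite complete fan $\Sigma$ in $\mathbb{R}^n$ with a partial order $\mathcal P$ on its set of maximal ($n$-dimensional) cones such that the union of the maximal cones in any interval of $\mathcal P$ is a (not necessarily simplicial or strongly convex) polyhedral cone, and for each $\sigma\in\Sigma$ the set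 of maximal cones containing $\sigma$ is an interval $[\sigma^-,\sigma^+]$ of $\mathcal P$. Each covering relation of $\mathcal P$ is labelled by the codimension-one cone in which the two maximal cones meet. The \emph{picture group} $G(\Sigma,\mathfrak P,\mathcal P)$ has generators $X_{[\sigma]}$ for the classes of codimension-one cones $\sigma$, and the following relations: (i) the words $X_{[\sigma_1]}\cdots X_{[\sigma_k]}$ formed from the labels of the arrows of any two maximal chains of the same interval $[\tau_1,\tau_2]$, read from $\tau_2$ down to $\tau_1$, are equal, their common value being denoted $X_{[\tau_1,\tau_2]}$; (ii) $X_{[\sigma_1^-,\kappa_1^-]}=X_{[\sigma_2^-,\kappa_2^-]}$ whenever $[f_{\sigma_1\kappa_1}]=[f_{\sigma_2\kappa_2}]$ in $\mathfrak C(\Sigma,\mathfrak P)$. The triple $(\Sigma,\mathfrak P,\mathcal P)$ is \emph{non-degenerate} if no relation of type (ii) has the form $X_{[\sigma]}=e$ with $\sigma$ a codimension-one cone. \textbf{Theorem.} Let $(\Sigma,\mathcal P)$ be a fan poset and let $\mathfrak P_1,\mathfrak P_2$ be admissible partitions of $\Sigma$ such that $\mathfrak P_1$ is finer than $\mathfrak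 P_2$. Then: \begin{enumerate} \item There is a faithful, surjective-on-objects functor $F:\mathfrak C(\Sigma,\mathfrak P_1)\to\mathfrak C(\Sigma,\mathfrak P_2)$ with $F([\sigma]_{\mathfrak P_1})=[\sigma]_{\mathfrak P_2}$ for all $\sigma\in\Sigma$. \item $F$ can be chosen so that, in addition, it induces a homeomorphism $\mathcal B\mathfrak C(\Sigma,\mathfrak P_1)/{\sim}\;\cong\;\mathcal B\mathfrak C(\Sigma,\mathfrak P_2)$, where $\sim$ is the equivalence relation generated by identifying the cells $e([\sigma_1]_{\mathfrak P_1})$ and $e([\sigma_2]_{\mathfrak P_1})$ whenever $[\sigma_1]_{\mathfrak P_2}=[\sigma_2]_{\mathfrak P_2}$, along the homeomorphism $|\mathrm{star}(\sigma_1)|\cong|\mathrm{star}(\sigma_2)|$ induced by the poset isomorphism that matches $\tau_1$ with $\tau_2$ when $\pi_{\sigma_1}(\tau_1)=\pi_{\sigma_2}(\tau_2)$. \item If $(\Sigma,\mathfrak P_2,\mathcal P)$ is non-degenerate, then there is an isomorphism $G(\Sigma,\mathfrak P_1,\mathcal P)/I\cong G(\Sigma,\mathfrak P_2,\mathcal P)$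 sending the class of $X_{[\sigma]_{\mathfrak P_1}}$ to $X_{[\sigma]_{\mathfrak P_2}}$ for every codimension-one cone $\sigma$, where $I$ is the normal subgroup generated by the elements $X_{[\sigma_1]_{\mathfrak P_1}}X_{[\sigma_2]_{\mathfrak P_1}}^{-1}$ for codimension-one cones $\sigma_1,\sigma_2$ with $[\sigma_1]_{\mathfrak P_1}\ne[\sigma_2]_{\mathfrak P_1}$ and $[\sigma_1]_{\mathfrak P_2}=[\sigma_2]_{\mathfrak P_2}$. \end{enumerate} -/

import Mathlib

open CategoryTheory

/-! ## Fans -/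

/-- The ambient Euclidean space `ℝⁿ`. -/
abbrev RSpace (n : ℕ) : Type := EuclideanSpace ℝ (Fin n)

namespace ConeGeometry

variable {n : ℕ}

/-- The linear span of a cone. -/
def linSpan (σ : PointedCone ℝ (RSpace n)) : Submodule ℝ (RSpace n) :=
  Submodule.span ℝ (σ : Set (RSpace n))

/-- The dimension of a cone is the dimension of its linear span. -/
noncomputable def dim (σ : PointedCone ℝ (RSpace n)) : ℕ :=
  Module.finrank ℝ (linSpan σ)

/-- The projection `π_σ` onto the orthogonal complement of `span σ`, as a map `ℝⁿ → ℝⁿ`. -/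
noncomputable def proj (σ : PointedCone ℝ (RSpace n)) : RSpace n →L[ℝ] RSpace n :=
  (linSpan σ)ᗮ.starProjection

/-- `F` is a face of `σ`: the intersection of `σ` with a supporting hyperplane `u^⊥`
(where `u = 0`, giving `F = σ`, is allowed). -/
def IsFace (F σ : PointedCone ℝ (RSpace n)) : Prop :=
  ∃ u : RSpace n, (∀ w ∈ σ, 0 ≤ inner ℝ u w) ∧
    (F : Set (RSpace n)) = {v | v ∈ σ ∧ inner ℝ u v = 0}

/-- A set is a (not necessarily strongly convex or simplicial) convex polyhedral cone if it is the
set of non-negative combinations of finitely many vectors. -/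
def IsPolyhedralCone (A : Set (RSpace n)) : Prop :=
  ∃ s : Set (RSpace n), s.Finite ∧ A = (PointedCone.hull ℝ s : Set (RSpace n))

end ConeGeometry

open ConeGeometry

/-- A (simplicial) fan in `ℝⁿ`: a collection of simplicial cones closed under taking faces, in which
any two cones meet in a common face. Cones generated by linearly independent vectors are
automatically strongly convex. -/
structure SimplicialFan (n : ℕ) where
  cones : Set (PointedCone ℝ (RSpace n))
  simplicial : ∀ σ ∈ cones, σ.IsSimplicial
  face_mem : ∀ σ ∈ cones, ∀ F, IsFace F σ → F ∈ cones
  inter_face : ∀ σ ∈ cones, ∀ τ ∈ cones, IsFace (σ ⊓ τ) σ ∧ IsFace (σ ⊓ τ) τ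

namespace SimplicialFan

variable {n : ℕ}

/-- The cones of a fan, as a type; it is partially ordered by inclusion. -/
abbrev Cone (S : SimplicialFan n) : Type := {σ : PointedCone ℝ (RSpace n) // σ ∈ S.cones}

/-- The star of `σ`: the cones of the fan containing `σ`, ordered by inclusion. -/
abbrev Star {S : SimplicialFan n} (σ : S.Cone) : Type := {τ : S.Cone // σ ≤ τ}

/-- The image `π_σ(τ)`. -/
def image {S : SimplicialFan n} (σ τ : S.Cone) : Set (RSpace n) :=
  proj σ.1 '' (τ.1 : Set (RSpace n))

/-- The projected star `π_σ(star σ)`, a collection of subsets of `(span σ)^⊥`. -/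
def projStar {S : SimplicialFan n} (σ : S.Cone) : Set (Set (RSpace n)) :=
  {A | ∃ τ : S.Cone, σ ≤ τ ∧ A = image σ τ}

/-- `σ₁` and `σ₂` are potentially identified: they have the same orthogonal complement and the same
projected star. -/
def Potential {S : SimplicialFan n} (σ₁ σ₂ : S.Cone) : Prop :=
  (linSpan σ₁.1)ᗮ = (linSpan σ₂.1)ᗮ ∧ projStar σ₁ = projStar σ₂

/-- An admissible partition of a fan, given by its equivalence relation: only potential
identifications are made, and if `σ₁ ∼ σ₂`, then any `τ₁ ⊇ σ₁`, `τ₂ ⊇ σ₂` with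
`π_{σ₁}(τ₁) = π_{σ₂}(τ₂)` satisfy `τ₁ ∼ τ₂`. -/
structure AdmissiblePartition (S : SimplicialFan n) extends Setoid S.Cone where
  potential : ∀ σ₁ σ₂, r σ₁ σ₂ → Potential σ₁ σ₂
  admissible : ∀ σ₁ σ₂ τ₁ τ₂ : S.Cone, r σ₁ σ₂ → σ₁ ≤ τ₁ → σ₂ ≤ τ₂ →
    image σ₁ τ₁ = image σ₂ τ₂ → r τ₁ τ₂

/-! ### Elementary facts needed for composition in the category of a partitioned fan -/

section Facts

variable {S : SimplicialFan n}

lemma exists_sub_of_mem_linSpan (σ : PointedCone ℝ (RSpace n)) {x : RSpace n}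
    (hx : x ∈ linSpan σ) : ∃ a ∈ σ, ∃ b ∈ σ, x = a - b := by
  unfold linSpan at hx
  induction hx using Submodule.span_induction with
  | mem x h => exact ⟨x, h, 0, σ.zero_mem, by simp⟩
  | zero => exact ⟨0, σ.zero_mem, 0, σ.zero_mem, by simp⟩
  | add x y _ _ h1 h2 =>
    obtain ⟨a, ha, b, hb, rfl⟩ := h1
    obtain ⟨c, hc, d, hd, rfl⟩ := h2
    exact ⟨a + c, σ.add_mem ha hc, b + d, σ.add_mem hb hd, by abel⟩
  | smul r x _ h =>
    obtain ⟨a, ha, b, hb, rfl⟩ := h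
    rcases le_total 0 r with hr | hr
    · exact ⟨r • a, PointedCone.smul_mem σ hr ha, r • b, PointedCone.smul_mem σ hr hb,
        smul_sub _ _ _⟩
    · refine ⟨(-r) • b, PointedCone.smul_mem σ (by linarith) hb, (-r) • a,
        PointedCone.smul_mem σ (by linarith) ha, ?_⟩
      rw [smul_sub, neg_smul, neg_smul]; abel

/-- A finitely generated cone has a point `w` such that any face containing `w + c`, with `c` in the
cone, is the whole cone. -/
lemma exists_interior_point (κ : PointedCone ℝ (RSpace n)) (hκ : κ.IsSimplicial) :
    ∃ w ∈ κ, ∀ c ∈ κ, ∀ F, IsFace F κ → w + c ∈ F → F = κ := by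
  obtain ⟨s, hs, -, rfl⟩ := hκ
  have hmem : ∀ v ∈ hs.toFinset, v ∈ PointedCone.hull ℝ s := fun v hv =>
    PointedCone.subset_hull (hs.mem_toFinset.1 hv)
  refine ⟨∑ v ∈ hs.toFinset, v, Submodule.sum_mem _ hmem, ?_⟩
  rintro c hc F ⟨u, hu, hF⟩ hw
  have h1 : inner ℝ u ((∑ v ∈ hs.toFinset, v) + c) = 0 := by
    have : (∑ v ∈ hs.toFinset, v) + c ∈ (F : Set (RSpace n)) := hw
    rw [hF] at this
    exact this.2
  rw [inner_add_right, inner_sum] at h1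
  have h2 : ∀ v ∈ hs.toFinset, 0 ≤ inner ℝ u v := fun v hv => hu v (hmem v hv)
  have h3 : ∑ v ∈ hs.toFinset, inner ℝ u v = 0 := by
    have := Finset.sum_nonneg h2
    have := hu c hc
    linarith
  have h4 := (Finset.sum_eq_zero_iff_of_nonneg h2).1 h3
  have h5 : ∀ x ∈ PointedCone.hull ℝ s, inner ℝ u x = 0 := by
    intro x hx
    induction hx using Submodule.span_induction with
    | mem x h => exact h4 x (hs.mem_toFinset.2 h)
    | zero => simp
    | add x y _ _ h1 h2 => rw [inner_add_right, h1, h2, add_zero]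
    | smul r x _ h =>
      have : r • x = (r : ℝ) • x := rfl
      rw [this, inner_smul_right, h, mul_zero]
  apply SetLike.coe_injective
  rw [hF]
  ext x
  exact ⟨fun h => h.1, fun h => ⟨h, h5 x h⟩⟩

lemma sub_mem_of_proj_eq (σ : PointedCone ℝ (RSpace n)) {x y : RSpace n}
    (h : proj σ x = proj σ y) : x - y ∈ linSpan σ := by
  have h0 : proj σ (x - y) = 0 := by rw [map_sub, h, sub_self]
  have := (Submodule.starProjection_apply_eq_zero_iff (K := (linSpan σ)ᗮ)).1 h0
  rwa [Submodule.orthogonal_orthogonal] at this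

/-- Inclusion in the star of `σ` can be tested after projection. -/
lemma le_of_image_subset {σ κ τ : S.Cone} (hκ : σ ≤ κ) (hτ : σ ≤ τ)
    (h : image σ κ ⊆ image σ τ) : κ ≤ τ := by
  obtain ⟨w, hw, hface⟩ := exists_interior_point κ.1 (S.simplicial _ κ.2)
  obtain ⟨t, ht, hpt⟩ := h ⟨w, hw, rfl⟩
  obtain ⟨a, ha, b, hb, hab⟩ := exists_sub_of_mem_linSpan _ (sub_mem_of_proj_eq _ hpt.symm)
  have hsum : w + b = t + a := by
    have : w = a - b + t := by rw [← hab]; abel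
    rw [this]; abel
  have hF := hface b (hκ hb) (κ.1 ⊓ τ.1) (S.inter_face _ κ.2 _ τ.2).1
    ⟨κ.1.add_mem hw (hκ hb), by rw [hsum]; exact τ.1.add_mem ht (hτ ha)⟩
  exact inf_eq_left.1 hF

lemma eq_of_image_eq {σ κ τ : S.Cone} (hκ : σ ≤ κ) (hτ : σ ≤ τ)
    (h : image σ κ = image σ τ) : κ = τ :=
  le_antisymm (le_of_image_subset hκ hτ h.subset) (le_of_image_subset hτ hκ h.symm.subset)

lemma proj_eq_of_potential {σ₁ σ₂ : S.Cone} (h : Potential σ₁ σ₂) :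
    proj σ₁.1 = proj σ₂.1 := by
  unfold proj
  simp only [h.1]

lemma image_image {σ κ τ : S.Cone} (h : σ ≤ κ) :
    proj κ.1 '' image σ τ = image κ τ := by
  have hle : (linSpan κ.1)ᗮ ≤ (linSpan σ.1)ᗮ :=
    Submodule.orthogonal_le (Submodule.span_mono h)
  have hc := Submodule.starProjection_comp_starProjection_of_le hle
  unfold image
  rw [Set.image_image]
  refine Set.image_congr fun x _ => ?_
  exact congrArg (fun f : RSpace n →L[ℝ] RSpace n => f x) hc

variable (P : S.AdmissiblePartition)

lemma AdmissiblePartition.exists_match {σ₁ σ₂ τ₁ : S.Cone} (h : P.r σ₁ σ₂) (hτ : σ₁ ≤ τ₁) :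
    ∃ τ₂ : S.Cone, σ₂ ≤ τ₂ ∧ image σ₁ τ₁ = image σ₂ τ₂ := by
  have hm : image σ₁ τ₁ ∈ projStar σ₂ := by
    rw [← (P.potential _ _ h).2]; exact ⟨τ₁, hτ, rfl⟩
  exact hm

/-- Matched cones have matched relative positions. -/
lemma AdmissiblePartition.image_eq {σ₁ σ₂ κ₁ κ₂ τ₁ τ₂ : S.Cone} (hσ : P.r σ₁ σ₂)
    (h1 : σ₁ ≤ κ₁) (h2 : σ₂ ≤ κ₂) (hκ : image σ₁ κ₁ = image σ₂ κ₂)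
    (hτ : image σ₁ τ₁ = image σ₂ τ₂) : image κ₁ τ₁ = image κ₂ τ₂ := by
  have hr := P.admissible _ _ _ _ hσ h1 h2 hκ
  rw [← image_image h1, ← image_image h2, hτ, proj_eq_of_potential (P.potential _ _ hr)]

/-- Identification of morphisms is compatible with composition. -/
lemma AdmissiblePartition.image_trans {σ₁ σ₂ κ₁ κ₂ τ₁ τ₂ : S.Cone} (hσ : P.r σ₁ σ₂)
    (h1 : σ₁ ≤ κ₁) (h2 : σ₂ ≤ κ₂) (h1' : κ₁ ≤ τ₁) (h2' : κ₂ ≤ τ₂)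
    (hκ : image σ₁ κ₁ = image σ₂ κ₂) (hτ : image κ₁ τ₁ = image κ₂ τ₂) :
    image σ₁ τ₁ = image σ₂ τ₂ := by
  obtain ⟨τ, hle, heq⟩ := P.exists_match hσ (h1.trans h1')
  have hsub : κ₂ ≤ τ := by
    refine le_of_image_subset h2 hle ?_
    rw [← hκ, ← heq]
    exact Set.image_mono h1'
  have := P.image_eq hσ h1 h2 hκ heq
  rw [heq, eq_of_image_eq hsub h2' (this.symm.trans hτ)]

end Facts

namespace AdmissiblePartition

variable {S : SimplicialFan n} (P : S.AdmissiblePartition)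

/-! ## The category of a partitioned fan -/

/-- The objects of the category of the partitioned fan: the equivalence classes `[σ]`. -/
def Cat : Type := Quotient P.toSetoid

/-- The class `[σ]`. -/
def cls (σ : S.Cone) : P.Cat := Quotient.mk P.toSetoid σ

variable {P}

lemma cls_eq {σ τ : S.Cone} : P.cls σ = P.cls τ ↔ P.r σ τ := Quotient.eq

/-- An element of the union of the sets `Hom_Σ(σ, τ)` over `σ ∈ X` and `τ ∈ Y`: an inclusion
`f_{στ}` of cones `σ ⊆ τ` with `[σ] = X` and `[τ] = Y`. -/
structure PreHom (X Y : P.Cat) : Type where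
  src : S.Cone
  tgt : S.Cone
  le : src ≤ tgt
  src_eq : P.cls src = X
  tgt_eq : P.cls tgt = Y

/-- `f_{σ₁τ₁} ∼ f_{σ₂τ₂}` if and only if `π_{σ₁}(τ₁) = π_{σ₂}(τ₂)`. -/
def homSetoid (X Y : P.Cat) : Setoid (PreHom X Y) where
  r f g := image f.src f.tgt = image g.src g.tgt
  iseqv := ⟨fun _ => rfl, fun h => h.symm, fun h h' => h.trans h'⟩

/-- The morphisms `X ⟶ Y`. -/
def Hom (X Y : P.Cat) : Type := Quotient (homSetoid X Y)

/-- The class `[f_{στ}]`. -/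
def PreHom.toHom {X Y : P.Cat} (f : PreHom X Y) : Hom X Y := Quotient.mk (homSetoid X Y) f

lemma PreHom.toHom_eq {X Y : P.Cat} {f g : PreHom X Y} :
    f.toHom = g.toHom ↔ image f.src f.tgt = image g.src g.tgt :=
  Quotient.eq (r := homSetoid X Y)

lemma PreHom.rel_src {X Y : P.Cat} (f g : PreHom X Y) : P.r f.src g.src :=
  cls_eq.1 (f.src_eq.trans g.src_eq.symm)

lemma exists_rebase {X Y : P.Cat} (g : PreHom X Y) {κ : S.Cone} (hκ : P.cls κ = X) :
    ∃ g' : PreHom X Y, g'.src = κ ∧ g'.toHom = g.toHom := by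
  have hr : P.r g.src κ := cls_eq.1 (g.src_eq.trans hκ.symm)
  obtain ⟨τ, hle, heq⟩ := P.exists_match hr g.le
  exact ⟨⟨κ, τ, hle, hκ, (cls_eq.2 (P.admissible _ _ _ _ hr g.le hle heq)).symm.trans g.tgt_eq⟩,
    rfl, PreHom.toHom_eq.2 heq.symm⟩

/-- The representative of `[g]` with a prescribed source. -/
noncomputable def rebase {X Y : P.Cat} (g : PreHom X Y) (κ : S.Cone) (hκ : P.cls κ = X) :
    PreHom X Y := (exists_rebase g hκ).choose

lemma rebase_src {X Y : P.Cat} (g : PreHom X Y) (κ : S.Cone) (hκ : P.cls κ = X) :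
    (rebase g κ hκ).src = κ := (exists_rebase g hκ).choose_spec.1

lemma rebase_toHom {X Y : P.Cat} (g : PreHom X Y) (κ : S.Cone) (hκ : P.cls κ = X) :
    (rebase g κ hκ).toHom = g.toHom := (exists_rebase g hκ).choose_spec.2

/-- The composite `f_{στ}` of `f_{σκ}` and `f_{κτ}`. -/
def PreHom.compOf {X Y Z : P.Cat} (f : PreHom X Y) (g : PreHom Y Z) (h : f.tgt = g.src) :
    PreHom X Z :=
  ⟨f.src, g.tgt, f.le.trans (h.le.trans g.le), f.src_eq, g.tgt_eq⟩

lemma compOf_toHom_eq {X Y Z : P.Cat} {f f' : PreHom X Y} {g g' : PreHom Y Z}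
    (h : f.tgt = g.src) (h' : f'.tgt = g'.src) (hf : f.toHom = f'.toHom)
    (hg : g.toHom = g'.toHom) : (f.compOf g h).toHom = (f'.compOf g' h').toHom := by
  refine PreHom.toHom_eq.2 (P.image_trans (κ₁ := g.src) (κ₂ := g'.src) (f.rel_src f')
    (f.le.trans h.le) (f'.le.trans h'.le) g.le g'.le ?_ (PreHom.toHom_eq.1 hg))
  rw [← h, ← h']
  exact PreHom.toHom_eq.1 hf

/-- Composition of morphisms: `[f_{κτ}] ∘ [f_{σκ}] = [f_{στ}]`, after choosing a representative of
the second morphism starting where the first one ends. -/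
noncomputable def comp {X Y Z : P.Cat} (f : Hom X Y) (g : Hom Y Z) : Hom X Z :=
  Quotient.liftOn₂ (s₁ := homSetoid X Y) (s₂ := homSetoid Y Z) f g
    (fun f g => (f.compOf (rebase g f.tgt f.tgt_eq) (rebase_src _ _ _).symm).toHom)
    fun _ _ _ _ hf hg => compOf_toHom_eq _ _ (Quotient.sound (s := homSetoid X Y) hf)
      ((rebase_toHom _ _ _).trans
        ((Quotient.sound (s := homSetoid Y Z) hg).trans (rebase_toHom _ _ _).symm))

lemma comp_toHom {X Y Z : P.Cat} (f : PreHom X Y) (g : PreHom Y Z) (h : f.tgt = g.src) :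
    comp f.toHom g.toHom = (f.compOf g h).toHom :=
  compOf_toHom_eq _ _ rfl (rebase_toHom _ _ _)

lemma exists_toHom {X Y : P.Cat} (f : Hom X Y) {κ : S.Cone} (hκ : P.cls κ = X) :
    ∃ f' : PreHom X Y, f'.src = κ ∧ f'.toHom = f := by
  obtain ⟨f, rfl⟩ := Quotient.exists_rep f
  exact exists_rebase f hκ

/-- The identity `[f_{σσ}]`. -/
noncomputable def idHom (X : P.Cat) : Hom X X :=
  PreHom.toHom ⟨Quotient.out X, Quotient.out X, le_rfl, Quotient.out_eq X, Quotient.out_eq X⟩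

lemma idHom_eq {X : P.Cat} (σ : S.Cone) (h : P.cls σ = X) :
    idHom X = PreHom.toHom ⟨σ, σ, le_rfl, h, h⟩ := by
  obtain ⟨f, hf, hid⟩ := exists_toHom (idHom X) h
  rw [← hid, PreHom.toHom_eq]
  have hr : P.r (Quotient.out X) σ := cls_eq.1 ((Quotient.out_eq X).trans h.symm)
  have h1 := PreHom.toHom_eq.1 hid
  have h2 : ∀ τ : S.Cone, image τ τ = {0} := by
    intro τ
    ext x
    constructor
    · rintro ⟨y, hy, rfl⟩
      refine (Submodule.starProjection_apply_eq_zero_iff (K := (linSpan τ.1)ᗮ)).2 ?_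
      exact Submodule.le_orthogonal_orthogonal _ (Submodule.subset_span hy)
    · rintro rfl
      exact ⟨0, τ.1.zero_mem, map_zero _⟩
  exact h1.trans ((h2 _).trans (h2 _).symm)

/-- The category of the partitioned fan. -/
noncomputable instance : Category P.Cat where
  Hom X Y := Hom X Y
  id X := idHom X
  comp f g := comp f g
  id_comp {X Y} f := by
    obtain ⟨f, rfl⟩ := Quotient.exists_rep f
    have := comp_toHom (X := X) (Y := X) (Z := Y) ⟨f.src, f.src, le_rfl, f.src_eq, f.src_eq⟩ f rfl
    rw [← idHom_eq] at this
    exact this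
  comp_id {X Y} f := by
    obtain ⟨f, rfl⟩ := Quotient.exists_rep f
    have := comp_toHom (X := X) (Y := Y) (Z := Y) f ⟨f.tgt, f.tgt, le_rfl, f.tgt_eq, f.tgt_eq⟩ rfl
    rw [← idHom_eq] at this
    exact this
  assoc {W X Y Z} f g h := by
    obtain ⟨f, rfl⟩ := Quotient.exists_rep f
    obtain ⟨g, hg, rfl⟩ := exists_toHom g f.tgt_eq
    obtain ⟨h, hh, rfl⟩ := exists_toHom h g.tgt_eq
    change comp (comp f.toHom g.toHom) h.toHom = comp f.toHom (comp g.toHom h.toHom)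
    exact (congrArg (fun k => comp k h.toHom) (comp_toHom f g hg.symm)).trans
      ((comp_toHom (f.compOf g hg.symm) h hh.symm).trans
        ((comp_toHom f (g.compOf h hh.symm) hg.symm).symm.trans
          (congrArg (fun k => comp f.toHom k) (comp_toHom g h hh.symm).symm)))

/-! ## Classifying spaces and their cells -/

/-- The classifying space of a small category: the geometric realisation of its nerve. -/
noncomputable abbrev _root_.ClassifyingSpace (C : Type) [Category.{0} C] : TopCat.{0} :=
  SSet.toTop.obj (nerve C)

/-- The continuous map of classifying spaces induced by a functor. -/
noncomputable abbrev _root_.classifyingMap {C D : Type} [Category.{0} C] [Category.{0} D]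
    (F : C ⥤ D) : ClassifyingSpace C ⟶ ClassifyingSpace D :=
  SSet.toTop.map (nerveMap F)

variable (P) in
/-- The functor from the star of `σ` (a poset) to the category of the partitioned fan,
`τ ↦ [τ]` and `(τ ⊆ τ') ↦ [f_{ττ'}]`. -/
noncomputable def starFunctor (σ : S.Cone) : Star σ ⥤ P.Cat where
  obj τ := P.cls τ.1
  map {τ τ'} f := PreHom.toHom ⟨τ.1, τ'.1, leOfHom f, rfl, rfl⟩
  map_id τ := (idHom_eq τ.1 rfl).symm
  map_comp {τ τ' τ''} f g := (comp_toHom (X := P.cls τ.1) (Y := P.cls τ'.1) (Z := P.cls τ''.1)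
    ⟨τ.1, τ'.1, leOfHom f, rfl, rfl⟩ ⟨τ'.1, τ''.1, leOfHom g, rfl, rfl⟩ rfl).symm

variable (P) in
/-- The characteristic map of the cell `e([σ])` of the classifying space. The intervals
`{κ | σ ⊆ κ ⊆ τ}` of the star of `σ` are the factorisation categories of the morphisms `[f_{στ}]`,
and the star itself is the under category of `[σ]`. Hence the realisation of the star is the closed
disk glued from the factorisation cubes of the `[f_{στ}]`, and `e([σ])` is its image. -/
noncomputable def cellMap (σ : S.Cone) :
    ClassifyingSpace (Star σ) ⟶ ClassifyingSpace P.Cat :=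
  classifyingMap (P.starFunctor σ)

variable (P) in
/-- The canonical bijection `star σ₁ → star σ₂` for `σ₁ ∼ σ₂`, sending `τ₁` to the cone `τ₂` with
`π_{σ₁}(τ₁) = π_{σ₂}(τ₂)`. -/
noncomputable def matching {σ₁ σ₂ : S.Cone} (h : P.r σ₁ σ₂) (τ : Star σ₁) : Star σ₂ :=
  ⟨(P.exists_match h τ.2).choose, (P.exists_match h τ.2).choose_spec.1⟩

variable (P) in
lemma image_matching {σ₁ σ₂ : S.Cone} (h : P.r σ₁ σ₂) (τ : Star σ₁) :
    image σ₁ τ.1 = image σ₂ (P.matching h τ).1 := (P.exists_match h τ.2).choose_spec.2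

variable (P) in
/-- The canonical isomorphism of posets `star σ₁ ≅ star σ₂` for `σ₁ ∼ σ₂`. -/
noncomputable def starIso {σ₁ σ₂ : S.Cone} (h : P.r σ₁ σ₂) : Star σ₁ ≃o Star σ₂ where
  toFun := P.matching h
  invFun := P.matching (P.symm h)
  left_inv τ := Subtype.ext (eq_of_image_eq (P.matching (P.symm h) _).2 τ.2
    ((P.image_matching h τ).trans (P.image_matching (P.symm h) _)).symm)
  right_inv τ := Subtype.ext (eq_of_image_eq (P.matching h _).2 τ.2
    ((P.image_matching (P.symm h) τ).trans (P.image_matching h _)).symm)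
  map_rel_iff' {τ τ'} := by
    constructor
    · intro hle
      refine le_of_image_subset τ.2 τ'.2 ?_
      rw [P.image_matching h τ, P.image_matching h τ']
      exact Set.image_mono hle
    · intro hle
      refine le_of_image_subset (P.matching h τ).2 (P.matching h τ').2 ?_
      change image σ₂ (P.matching h τ).1 ⊆ image σ₂ (P.matching h τ').1
      rw [← P.image_matching h τ, ← P.image_matching h τ']
      exact Set.image_mono hle

/-- The relation on the classifying space of `P₁` that identifies the cells `e([σ₁]_{P₁})` and
`e([σ₂]_{P₁})` whenever `[σ₁]_{P₂} = [σ₂]_{P₂}`: the point of `e([σ₁])` with coordinate `z` in the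
disk of `star σ₁` is identified with the point of `e([σ₂])` with the corresponding coordinate in
the disk of `star σ₂`. -/
def CellIdent (P₁ P₂ : S.AdmissiblePartition) (x y : ClassifyingSpace P₁.Cat) : Prop :=
  ∃ (σ₁ σ₂ : S.Cone) (h : P₂.r σ₁ σ₂) (z : ClassifyingSpace (Star σ₁)),
    P₁.cellMap σ₁ z = x ∧
      P₁.cellMap σ₂ (classifyingMap (P₂.starIso h).monotone.functor z) = y

end AdmissiblePartition

/-! ## Fan posets and picture groups -/

/-- The maximal cones of a (complete) fan in `ℝⁿ`: those of dimension `n`. No order is put on this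
type; in a fan poset it carries an additional partial order, unrelated to inclusion. -/
def MaxCone (S : SimplicialFan n) : Type := {σ : S.Cone // dim σ.1 = n}

/-- The cones of codimension one. -/
def Wall (S : SimplicialFan n) : Type := {σ : S.Cone // dim σ.1 + 1 = n}

/-- The set of maximal cones containing `σ`. -/
def maxStar {S : SimplicialFan n} (σ : S.Cone) : Set S.MaxCone := {τ | σ ≤ τ.1}

/-- A fan poset: a finite complete fan with a partial order on its maximal cones such that the union
of the maximal cones in any interval is a convex polyhedral cone, and the set of maximal cones
containing a given cone is an interval. -/
structure IsFanPoset (S : SimplicialFan n) [PartialOrder S.MaxCone] : Prop where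
  finite : S.cones.Finite
  complete : ∀ v : RSpace n, ∃ σ ∈ S.cones, v ∈ σ
  interval_cone : ∀ a b : S.MaxCone, a ≤ b →
    IsPolyhedralCone (⋃ c ∈ Set.Icc a b, (c.1.1 : Set (RSpace n)))
  facial : ∀ σ : S.Cone, ∃ a b : S.MaxCone, a ≤ b ∧ maxStar σ = Set.Icc a b

section Picture

variable {S : SimplicialFan n} [PartialOrder S.MaxCone]

/-- The minimum `σ⁻` of the facial interval `[σ⁻, σ⁺]` of `σ`. -/
noncomputable def IsFanPoset.low (hS : IsFanPoset S) (σ : S.Cone) : S.MaxCone :=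
  (hS.facial σ).choose

lemma IsFanPoset.low_isLeast (hS : IsFanPoset S) (σ : S.Cone) :
    IsLeast (maxStar σ) (hS.low σ) := by
  obtain ⟨b, hb, h⟩ := (hS.facial σ).choose_spec
  rw [h]
  exact isLeast_Icc hb

/-- The index set of the generators of the picture group: classes `[σ]` of cones of codimension
one. -/
def AdmissiblePartition.WallClass (P : S.AdmissiblePartition) : Type :=
  Quotient (P.toSetoid.comap (Subtype.val : S.Wall → S.Cone))

/-- The class `[σ]` of a cone of codimension one. -/
def AdmissiblePartition.wallCls (P : S.AdmissiblePartition) (σ : S.Wall) : P.WallClass :=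
  Quotient.mk _ σ

/-- `ChainWord P a b w`: the word `w` is the sequence of classes of labels of the arrows of a
maximal chain of the interval `[a, b]`, that is, of a path `b → ⋯ → a` in the Hasse diagram, read
along the arrows from `b` down to `a`. An arrow `c → b`, where `c` covers `b`, is labelled with the
codimension one cone `b ∩ c`. -/
inductive ChainWord (P : S.AdmissiblePartition) (a : S.MaxCone) :
    S.MaxCone → List P.WallClass → Prop
  | nil : ChainWord P a a []
  | cons {b c : S.MaxCone} {w : List P.WallClass} (σ : S.Wall) (hbc : b ⋖ c)
      (hσ : σ.1.1 = b.1.1 ⊓ c.1.1) (hw : ChainWord P a b w) : ChainWord P a c (P.wallCls σ :: w)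

/-- The relations of the first type, as pairs of words: two words read off from maximal chains of
the same interval. -/
def FirstRel (P : S.AdmissiblePartition) (w w' : List P.WallClass) : Prop :=
  ∃ a b : S.MaxCone, ChainWord P a b w ∧ ChainWord P a b w'

/-- The relations of the second type, as pairs of words: `w` is read off from `[σ₁⁻, κ₁⁻]` and `w'`
from `[σ₂⁻, κ₂⁻]`, where `[f_{σ₁κ₁}] = [f_{σ₂κ₂}]`. -/
def SecondRel (hS : IsFanPoset S) (P : S.AdmissiblePartition) (w w' : List P.WallClass) : Prop :=
  ∃ (X Y : P.Cat) (f g : AdmissiblePartition.PreHom X Y), f.toHom = g.toHom ∧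
    ChainWord P (hS.low f.src) (hS.low f.tgt) w ∧ ChainWord P (hS.low g.src) (hS.low g.tgt) w'

/-- The element of the free group given by a word. -/
def wordElt {α : Type} (w : List α) : FreeGroup α := (w.map FreeGroup.of).prod

/-- The relators of the picture group. -/
def pictureRels (hS : IsFanPoset S) (P : S.AdmissiblePartition) : Set (FreeGroup P.WallClass) :=
  {x | ∃ w w' : List P.WallClass,
    (FirstRel P w w' ∨ SecondRel hS P w w') ∧ x = wordElt w * (wordElt w')⁻¹}

/-- The picture group of a partitioned fan poset. -/
def PictureGroup (hS : IsFanPoset S) (P : S.AdmissiblePartition) : Type :=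
  PresentedGroup (pictureRels hS P)

instance (hS : IsFanPoset S) (P : S.AdmissiblePartition) : Group (PictureGroup hS P) :=
  inferInstanceAs (Group (PresentedGroup (pictureRels hS P)))

/-- The generator `X_{[σ]}` of the picture group. -/
def pictureGen (hS : IsFanPoset S) (P : S.AdmissiblePartition) (σ : S.Wall) : PictureGroup hS P :=
  PresentedGroup.of (rels := pictureRels hS P) (P.wallCls σ)

/-- A partitioned fan poset is non-degenerate if no relation of the second type has the form
`X_{[σ]} = e`. -/
def NonDegenerate (hS : IsFanPoset S) (P : S.AdmissiblePartition) : Prop :=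
  ∀ σ : S.Wall, ¬ SecondRel hS P [P.wallCls σ] []

end Picture

end SimplicialFan

/-!
Everything rests on one fact from the definition of a partitioned fan: the class of an inclusion
`σ ⊆ τ` is recorded by the set `π_σ(τ)`, which does not mention the partition, and for fixed `σ`
it determines `τ`. Since the comparison functor `coarsen` sends `[f_{στ}]` to `[f_{στ}]`, it is
faithful.

*Classifying spaces.* A simplex of the nerve whose first vertex is `[σ]` lifts to a chain of cones
starting at `σ` (`exists_lift_functor`). Hence the comparison of nerves is surjective in each
degree, and two simplices over `P₁` agree over `P₂` exactly if they come from chains in two stars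
that correspond under `starIso` (`exists_lift_pair`). So the nerve over `P₂` is the quotient of
the nerve over `P₁` by the identifications of the nerves of stars (`exists_nerve_factor`). As
geometric realisation is left adjoint to the singular complex, the map from the classifying space
over `P₁` to its quotient by `CellIdent` factors through the classifying space over `P₂`, and the
factorisation is inverse to the map induced by `coarsen` (`exists_homeomorph_quot_cellIdent`).

*Picture groups.* The words of maximal chains over `P₁` and over `P₂` are the same up to renaming
letters, so `X_{[σ]} ↦ X_{[σ]}` is a homomorphism that kills the merged generators, and its
inverse is defined on generators. That the inverse respects the relations of the first type is
clear. For the second type, the point is that in a non-degenerate triple these relations are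
already of the first type (`SecondRel.firstRel`). If `σ₁ ∼ σ₂`, the canonical matching of the
stars carries walls to walls and maximal cones to maximal cones. A wall lies in at most two
maximal cones (`Wall.eq_or_eq`), and the maximal cones containing it form an interval, so covering
relations are carried to covering relations up to reversal; a reversal would give a relation
`X_{[σ]} = e` (`IsFanPoset.covBy_of_matched`). Conversely every covering relation crosses a wall,
because the union of the two cones is convex (`dim_inf_of_convex_union`). Hence the matching is an
isomorphism of the facial intervals of `σ₁` and `σ₂`; it preserves the minima `κ⁻` and takes the
labelled maximal chains of `[σ₁⁻, κ₁⁻]` to those of `[σ₂⁻, κ₂⁻]`.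
-/

/-! ### Lifting chains of morphisms and the comparison functor -/

namespace SimplicialFan

namespace AdmissiblePartition

variable {n : ℕ} {S : SimplicialFan n} {P : S.AdmissiblePartition}

/-- The common projected image `π_σ(τ)` of the representatives `f_{στ}` of a morphism. -/
def homImage {X Y : P.Cat} (f : X ⟶ Y) : Set (RSpace n) :=
  Quotient.lift (s := homSetoid X Y) (fun f : PreHom X Y => image f.src f.tgt) (fun _ _ h => h) f

lemma toHom_heq {X Y : P.Cat} (g : PreHom X Y) {σ τ : S.Cone} (h : σ ≤ τ) (hs : g.src = σ)
    (ht : g.tgt = τ) :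
    HEq (PreHom.toHom (P := P) ⟨σ, τ, h, rfl, rfl⟩) g.toHom := by
  obtain ⟨a, b, hle, rfl, rfl⟩ := g
  subst hs ht
  rfl

/-- Every chain of morphisms starting at `[σ]` lifts to a chain of cones starting at `σ`. -/
lemma exists_lift_functor {k : ℕ} (x : Fin (k + 1) ⥤ P.Cat) (σ : S.Cone)
    (hσ : P.cls σ = x.obj 0) :
    ∃ z : Fin (k + 1) ⥤ Star σ, (z.obj 0).1 = σ ∧ z ⋙ P.starFunctor σ = x := by
  choose f hsrc hf using fun i : Fin (k + 1) =>
    exists_toHom (P := P) (x.map (homOfLE (Fin.zero_le i))) hσ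
  have hle : ∀ i, σ ≤ (f i).tgt := fun i => (hsrc i).symm.le.trans (f i).le
  have key : ∀ i j (h : i ⟶ j), ∃ g : PreHom (x.obj i) (x.obj j),
      g.src = (f i).tgt ∧ g.tgt = (f j).tgt ∧ g.toHom = x.map h := by
    intro i j h
    obtain ⟨g, hg, hgx⟩ := exists_toHom (P := P) (x.map h) (f i).tgt_eq
    refine ⟨g, hg, ?_, hgx⟩
    have h1 : (PreHom.compOf (f i) g hg.symm).toHom = (f j).toHom := by
      rw [← comp_toHom, hf, hf, hgx]
      exact (x.map_comp _ _).symm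
    have h2 := PreHom.toHom_eq.1 h1
    change image (f i).src g.tgt = _ at h2
    rw [hsrc, hsrc] at h2
    exact eq_of_image_eq ((hle i).trans (hg.symm.le.trans g.le)) (hle j) h2
  have hmono : Monotone fun i => (⟨(f i).tgt, hle i⟩ : Star σ) := by
    intro i j hij
    obtain ⟨g, hg, hg', -⟩ := key i j (homOfLE hij)
    change (f i).tgt ≤ (f j).tgt
    rw [← hg, ← hg']
    exact g.le
  refine ⟨hmono.functor, ?_, ?_⟩
  · have h1 : (f 0).toHom = PreHom.toHom ⟨σ, σ, le_rfl, hσ, hσ⟩ := by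
      rw [hf, ← idHom_eq]
      exact x.map_id 0
    have h2 := PreHom.toHom_eq.1 h1
    rw [hsrc] at h2
    exact eq_of_image_eq (hle 0) le_rfl h2
  · refine CategoryTheory.Functor.hext (fun i => (f i).tgt_eq) fun i j h => ?_
    obtain ⟨g, hg, hg', hgx⟩ := key i j h
    rw [← hgx]
    exact toHom_heq g _ hg hg'

section Refinement

variable {P₁ P₂ : S.AdmissiblePartition} (hfiner : ∀ σ τ : S.Cone, P₁.r σ τ → P₂.r σ τ)

/-- The map `[σ]_{P₁} ↦ [σ]_{P₂}`, for `P₁` finer than `P₂`. -/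
def coarsenObj (X : P₁.Cat) : P₂.Cat :=
  Quotient.map' (s₁ := P₁.toSetoid) (s₂ := P₂.toSetoid) id hfiner X

/-- An inclusion of cones, seen between the classes of a coarser partition. -/
def PreHom.coarsen {X Y : P₁.Cat} (f : PreHom X Y) :
    PreHom (coarsenObj hfiner X) (coarsenObj hfiner Y) :=
  ⟨f.src, f.tgt, f.le, congrArg (coarsenObj hfiner) f.src_eq,
    congrArg (coarsenObj hfiner) f.tgt_eq⟩

/-- The comparison functor `[σ]_{P₁} ↦ [σ]_{P₂}`, `[f_{στ}] ↦ [f_{στ}]`. -/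
def coarsen : P₁.Cat ⥤ P₂.Cat where
  obj := coarsenObj hfiner
  map {X Y} f := Quotient.map' (s₁ := homSetoid X Y)
    (s₂ := homSetoid (coarsenObj hfiner X) (coarsenObj hfiner Y))
    (PreHom.coarsen hfiner) (fun _ _ h => h) f
  map_id X := by
    obtain ⟨σ, rfl⟩ := Quotient.exists_rep X
    refine Eq.trans ?_ (idHom_eq (P := P₂) σ rfl).symm
    exact congrArg (Quotient.map' (s₁ := homSetoid _ _) (s₂ := homSetoid _ _)
      (PreHom.coarsen hfiner) (fun _ _ h => h)) (idHom_eq (P := P₁) σ rfl)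
  map_comp {X Y Z} f g := by
    obtain ⟨f, rfl⟩ := Quotient.exists_rep f
    obtain ⟨g, hg, rfl⟩ := exists_toHom g f.tgt_eq
    refine Eq.trans ?_ (comp_toHom (PreHom.coarsen hfiner f) (PreHom.coarsen hfiner g)
      hg.symm).symm
    exact congrArg (Quotient.map' (s₁ := homSetoid _ _) (s₂ := homSetoid _ _)
      (PreHom.coarsen hfiner) (fun _ _ h => h)) (comp_toHom f g hg.symm)

lemma coarsen_faithful : (coarsen hfiner).Faithful where
  map_injective {X Y} f g h := by
    obtain ⟨f, rfl⟩ := Quotient.exists_rep f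
    obtain ⟨g, rfl⟩ := Quotient.exists_rep g
    have h' : (PreHom.coarsen hfiner f).toHom = (PreHom.coarsen hfiner g).toHom := h
    have him := PreHom.toHom_eq.1 h'
    exact PreHom.toHom_eq.2 him

lemma coarsen_obj_surjective : Function.Surjective (coarsen hfiner).obj := by
  intro X
  obtain ⟨σ, rfl⟩ := Quotient.exists_rep X
  exact ⟨P₁.cls σ, rfl⟩

lemma starFunctor_coarsen (σ : S.Cone) :
    P₁.starFunctor σ ⋙ coarsen hfiner = P₂.starFunctor σ := rfl

/-- The canonical isomorphism of stars is compatible with the maps to the category of the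
partitioned fan. -/
lemma starIso_starFunctor (P : S.AdmissiblePartition) {σ₁ σ₂ : S.Cone} (h : P.r σ₁ σ₂) :
    (P.starIso h).monotone.functor ⋙ P.starFunctor σ₂ = P.starFunctor σ₁ := by
  have him : ∀ τ : Star σ₁, image σ₁ τ.1 = image σ₂ (P.starIso h τ).1 :=
    P.image_matching h
  have hr : ∀ τ : Star σ₁, P.r τ.1 (P.starIso h τ).1 := fun τ =>
    P.admissible _ _ _ _ h τ.2 (P.starIso h τ).2 (him τ)
  refine CategoryTheory.Functor.hext (fun τ => (cls_eq.2 (hr τ)).symm) fun τ τ' f => ?_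
  let g : PreHom (P.cls τ.1) (P.cls τ'.1) :=
    ⟨(P.starIso h τ).1, (P.starIso h τ').1, (P.starIso h).monotone (leOfHom f),
      (cls_eq.2 (hr τ)).symm, (cls_eq.2 (hr τ')).symm⟩
  have hg : g.toHom = (P.starFunctor σ₁).map f :=
    PreHom.toHom_eq.2 (P.image_eq h τ.2 (P.starIso h τ).2 (him τ) (him τ')).symm
  rw [← hg]
  exact toHom_heq g _ rfl rfl

/-- Two simplices of the nerve over `P₁` have the same image over `P₂` only if they correspond to
each other under the canonical isomorphism of the stars of two `P₂`-equivalent cones. -/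
lemma exists_lift_pair {k : ℕ} (x y : Fin (k + 1) ⥤ P₁.Cat)
    (hxy : x ⋙ coarsen hfiner = y ⋙ coarsen hfiner) :
    ∃ (σ₁ σ₂ : S.Cone) (h : P₂.r σ₁ σ₂) (z : Fin (k + 1) ⥤ Star σ₁),
      z ⋙ P₁.starFunctor σ₁ = x ∧
        (z ⋙ (P₂.starIso h).monotone.functor) ⋙ P₁.starFunctor σ₂ = y := by
  obtain ⟨σ₁, h₁⟩ := Quotient.exists_rep (x.obj 0)
  obtain ⟨σ₂, h₂⟩ := Quotient.exists_rep (y.obj 0)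
  obtain ⟨z, hz, rfl⟩ := exists_lift_functor x σ₁ h₁
  obtain ⟨z', hz', rfl⟩ := exists_lift_functor y σ₂ h₂
  have hr : P₂.r σ₁ σ₂ := by
    have h0 : (coarsen hfiner).obj (P₁.cls (z.obj 0).1) =
        (coarsen hfiner).obj (P₁.cls (z'.obj 0).1) := congrArg (fun F => F.obj 0) hxy
    rw [hz, hz'] at h0
    exact cls_eq.1 (show P₂.cls σ₁ = P₂.cls σ₂ from h0)
  refine ⟨σ₁, σ₂, hr, z, rfl, ?_⟩
  congr 1
  have hobj : ∀ i, (P₂.starIso hr) (z.obj i) = z'.obj i := by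
    intro i
    have hG : ∀ G H : Fin (k + 1) ⥤ P₂.Cat, G = H →
        homImage (G.map (homOfLE (Fin.zero_le i))) =
          homImage (H.map (homOfLE (Fin.zero_le i))) := by
      rintro G _ rfl
      rfl
    have him : image (z.obj 0).1 (z.obj i).1 = image (z'.obj 0).1 (z'.obj i).1 := hG _ _ hxy
    rw [hz, hz'] at him
    exact Subtype.ext (eq_of_image_eq (P₂.starIso hr (z.obj i)).2 (z'.obj i).2
      ((P₂.image_matching hr (z.obj i)).symm.trans him))
  exact CategoryTheory.Functor.hext hobj fun i j f => Subsingleton.helim (by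
    change ((P₂.starIso hr) (z.obj i) ⟶ (P₂.starIso hr) (z.obj j)) = _
    rw [hobj, hobj]) _ _

end Refinement

end AdmissiblePartition

end SimplicialFan

/-! ### The quotient of the classifying space -/

namespace SimplicialFan

namespace AdmissiblePartition

variable {n : ℕ} {S : SimplicialFan n}
variable {P₁ P₂ : S.AdmissiblePartition} (hfiner : ∀ σ τ : S.Cone, P₁.r σ τ → P₂.r σ τ)

lemma nerveMap_comp {C D E : Type} [Category.{0} C] [Category.{0} D] [Category.{0} E]
    (F : C ⥤ D) (G : D ⥤ E) : nerveMap (F ⋙ G) = nerveMap F ≫ nerveMap G := rfl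

lemma classifyingMap_comp {C D E : Type} [Category.{0} C] [Category.{0} D] [Category.{0} E]
    (F : C ⥤ D) (G : D ⥤ E) :
    classifyingMap (F ⋙ G) = classifyingMap F ≫ classifyingMap G := by
  unfold classifyingMap
  rw [nerveMap_comp, Functor.map_comp]

lemma nerveMap_coarsen_surjective (Δ : SimplexCategoryᵒᵖ) :
    Function.Surjective ((nerveMap (coarsen hfiner)).app Δ) := by
  intro x
  obtain ⟨σ, hσ⟩ : ∃ σ, P₂.cls σ = ComposableArrows.left x := Quotient.exists_rep _
  obtain ⟨z, -, hz⟩ := exists_lift_functor (P := P₂) x σ hσ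
  exact ⟨z ⋙ P₁.starFunctor σ, hz⟩

instance epi_nerveMap_coarsen : Epi (nerveMap (coarsen hfiner)) := by
  have : ∀ Δ, Epi ((nerveMap (coarsen hfiner)).app Δ) := fun Δ =>
    (epi_iff_surjective _).2 (nerveMap_coarsen_surjective hfiner Δ)
  exact NatTrans.epi_of_epi_app _

/-- A map out of the nerve over `P₁` that respects the identifications of the stars factors through
the nerve over `P₂`. -/
lemma exists_nerve_factor {T : SSet.{0}} (q : nerve P₁.Cat ⟶ T)
    (hq : ∀ (σ₁ σ₂ : S.Cone) (h : P₂.r σ₁ σ₂), nerveMap (P₁.starFunctor σ₁) ≫ q =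
      nerveMap (P₂.starIso h).monotone.functor ≫ nerveMap (P₁.starFunctor σ₂) ≫ q) :
    ∃ r : nerve P₂.Cat ⟶ T, nerveMap (coarsen hfiner) ≫ r = q := by
  have hwd : ∀ (Δ : SimplexCategoryᵒᵖ) (x y : (nerve P₁.Cat).obj Δ),
      (nerveMap (coarsen hfiner)).app Δ x = (nerveMap (coarsen hfiner)).app Δ y →
        q.app Δ x = q.app Δ y := by
    intro Δ x y hxy
    obtain ⟨σ₁, σ₂, h, z, rfl, rfl⟩ := exists_lift_pair hfiner x y hxy
    exact congrArg (fun f : nerve (Star σ₁) ⟶ T => f.app Δ z) (hq σ₁ σ₂ h)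
  have hinv := fun Δ => Function.surjInv_eq (nerveMap_coarsen_surjective hfiner Δ)
  refine ⟨{ app := fun Δ => ↾fun x =>
              q.app Δ (Function.surjInv (nerveMap_coarsen_surjective hfiner Δ) x)
            naturality := ?_ }, ?_⟩
  · intro Δ Δ' f
    ext x
    change q.app Δ' _ = T.map f (q.app Δ _)
    rw [← NatTrans.naturality_apply q f]
    apply hwd
    rw [hinv, NatTrans.naturality_apply (nerveMap (coarsen hfiner)) f, hinv]
    rfl
  · ext Δ x
    exact hwd _ _ _ (hinv _ _)

/-- The comparison functor induces a homeomorphism from the classifying space over `P₁`, with the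
cells of `P₂`-equivalent cones identified, to the classifying space over `P₂`. -/
theorem exists_homeomorph_quot_cellIdent :
    ∃ h : Quot (CellIdent P₁ P₂) ≃ₜ ClassifyingSpace P₂.Cat,
      ∀ x, h (Quot.mk _ x) = classifyingMap (coarsen hfiner) x := by
  let Q : TopCat.{0} := TopCat.of (Quot (CellIdent P₁ P₂))
  let q : ClassifyingSpace P₁.Cat ⟶ Q := TopCat.ofHom ⟨Quot.mk _, continuous_quot_mk⟩
  have hcell : ∀ (σ₁ σ₂ : S.Cone) (h : P₂.r σ₁ σ₂), P₁.cellMap σ₁ ≫ q =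
      classifyingMap (P₂.starIso h).monotone.functor ≫ P₁.cellMap σ₂ ≫ q := by
    intro σ₁ σ₂ h
    ext z
    exact Quot.sound ⟨σ₁, σ₂, h, z, rfl, rfl⟩
  have hF : ∀ x y, CellIdent P₁ P₂ x y →
      classifyingMap (coarsen hfiner) x = classifyingMap (coarsen hfiner) y := by
    rintro _ _ ⟨σ₁, σ₂, h, z, rfl, rfl⟩
    have e : P₁.cellMap σ₁ ≫ classifyingMap (coarsen hfiner) =
        classifyingMap (P₂.starIso h).monotone.functor ≫ P₁.cellMap σ₂ ≫
          classifyingMap (coarsen hfiner) := by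
      unfold cellMap
      rw [← classifyingMap_comp, ← classifyingMap_comp, ← classifyingMap_comp,
        starFunctor_coarsen, starFunctor_coarsen, starIso_starFunctor]
    exact congrArg (fun f : ClassifyingSpace (Star σ₁) ⟶ ClassifyingSpace P₂.Cat => f z) e
  let s : Q ⟶ ClassifyingSpace P₂.Cat :=
    TopCat.ofHom ⟨Quot.lift _ hF, continuous_quot_lift _ (classifyingMap _).hom.continuous⟩
  have hqs : q ≫ s = classifyingMap (coarsen hfiner) := rfl
  -- Factor the simplicial map adjoint to `q` through the nerve over `P₂`.
  obtain ⟨r, hr⟩ := exists_nerve_factor hfiner (sSetTopAdj.homEquiv _ _ q) (by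
    intro σ₁ σ₂ h
    rw [← Adjunction.homEquiv_naturality_left, ← Adjunction.homEquiv_naturality_left,
      ← Adjunction.homEquiv_naturality_left]
    exact congrArg _ (hcell σ₁ σ₂ h))
  let r' : ClassifyingSpace P₂.Cat ⟶ Q := (sSetTopAdj.homEquiv _ _).symm r
  have hr' : classifyingMap (coarsen hfiner) ≫ r' = q := by
    refine (Adjunction.homEquiv_naturality_left_symm _ _ _).symm.trans ?_
    rw [hr, Equiv.symm_apply_apply]
  have hrs : r' ≫ s = 𝟙 _ := by
    have : Epi (classifyingMap (coarsen hfiner)) :=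
      inferInstanceAs (Epi (SSet.toTop.map (nerveMap (coarsen hfiner))))
    rw [← cancel_epi (classifyingMap (coarsen hfiner)), ← Category.assoc, hr', hqs,
      Category.comp_id]
  have hsr : ∀ x, r' (s x) = x := by
    rintro ⟨x⟩
    exact congrArg (fun f : ClassifyingSpace P₁.Cat ⟶ Q => f x) hr'
  refine ⟨{ toFun := s, invFun := r', left_inv := hsr, right_inv := fun x =>
              congrArg (fun f : ClassifyingSpace P₂.Cat ⟶ ClassifyingSpace P₂.Cat => f x) hrs
            continuous_toFun := s.hom.continuous
            continuous_invFun := r'.hom.continuous }, fun x => rfl⟩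

end AdmissiblePartition

end SimplicialFan

/-! ### Walls and full-dimensional cones -/

namespace ConeGeometry

variable {n : ℕ}

/-- A simplicial cone is the image of the non-negative orthant under an injective linear map. -/
lemma isClosed_of_isSimplicial {σ : PointedCone ℝ (RSpace n)} (hσ : σ.IsSimplicial) :
    IsClosed (σ : Set (RSpace n)) := by
  obtain ⟨s, hs, hli, rfl⟩ := hσ
  have := hs.fintype
  let L : (s → ℝ) →ₗ[ℝ] RSpace n := Fintype.linearCombination ℝ (fun v : s => (v : RSpace n))
  have hL : Function.Injective L := by
    have := hli.fintypeLinearCombination_injective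
    exact this
  have hcl := (LinearMap.isClosedEmbedding_of_injective (LinearMap.ker_eq_bot.2 hL)).isClosedMap
    (Set.Ici 0) isClosed_Ici
  convert hcl using 1
  ext x
  have hs' : s = Set.range (fun v : s => (v : RSpace n)) := by simp
  constructor
  · intro hx
    rw [hs'] at hx
    obtain ⟨c, rfl⟩ := (Submodule.mem_span_range_iff_exists_fun _).1 hx
    exact ⟨fun v => c v, fun v => (c v).2, rfl⟩
  · rintro ⟨c, hc, rfl⟩
    change L c ∈ PointedCone.hull ℝ s
    exact Submodule.sum_mem _ fun v _ =>
      PointedCone.smul_mem _ (hc v) (PointedCone.subset_hull v.2)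

lemma linSpan_eq_top_of_dim {σ : PointedCone ℝ (RSpace n)} (h : dim σ = n) :
    linSpan σ = ⊤ :=
  Submodule.eq_top_of_finrank_eq (by simpa [dim] using h)

lemma linSpan_le_of_inner_eq_zero {σ : PointedCone ℝ (RSpace n)} {u : RSpace n}
    (h : ∀ v ∈ σ, inner ℝ u v = 0) : linSpan σ ≤ (ℝ ∙ u)ᗮ := by
  refine Submodule.span_le.2 fun v hv => ?_
  exact Submodule.mem_orthogonal_singleton_iff_inner_right.2 (h v hv)

/-- A face of a cone with the same dimension is the whole cone. -/
lemma IsFace.eq_of_dim_le {F σ : PointedCone ℝ (RSpace n)} (h : IsFace F σ)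
    (hd : dim σ ≤ dim F) : F = σ := by
  obtain ⟨u, hu, hF⟩ := h
  have hmem : ∀ v, v ∈ F ↔ v ∈ σ ∧ inner ℝ u v = 0 := fun v => Set.ext_iff.1 hF v
  have hspan : linSpan F = linSpan σ :=
    Submodule.eq_of_le_of_finrank_le (Submodule.span_mono fun v hv => ((hmem v).1 hv).1) hd
  have h1 : linSpan σ ≤ (ℝ ∙ u)ᗮ :=
    hspan ▸ linSpan_le_of_inner_eq_zero fun v hv => ((hmem v).1 hv).2
  ext v
  refine ⟨fun hv => ((hmem v).1 hv).1, fun hv => (hmem v).2 ⟨hv, ?_⟩⟩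
  exact Submodule.mem_orthogonal_singleton_iff_inner_right.1 (h1 (Submodule.subset_span hv))

lemma dim_le (σ : PointedCone ℝ (RSpace n)) : dim σ ≤ n := by
  simpa [dim] using Submodule.finrank_le (linSpan σ)

/-- Two distinct full-dimensional cones meeting in a common face and having convex union meet in
codimension one: a segment from a point of one cone off the span of the intersection to any point of
the other cone has to cross the intersection. -/
lemma dim_inf_of_convex_union {b c : PointedCone ℝ (RSpace n)} (hb : b.IsSimplicial)
    (hc : c.IsSimplicial) (hdb : dim b = n) (hdc : dim c = n) (hface : IsFace (b ⊓ c) c)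
    (hface' : IsFace (b ⊓ c) b) (hne : b ≠ c) (hconv : Convex ℝ ((b : Set (RSpace n)) ∪ c)) :
    dim (b ⊓ c) + 1 = n := by
  have hlt : dim (b ⊓ c) < n := by
    by_contra hcon
    have h1 := hface.eq_of_dim_le (by omega)
    have h2 := hface'.eq_of_dim_le (by omega)
    exact hne (h2.symm.trans h1)
  obtain ⟨p, hpc, hp⟩ : ∃ p ∈ c, p ∉ linSpan (b ⊓ c) := by
    by_contra! hcon
    have : linSpan c ≤ linSpan (b ⊓ c) := Submodule.span_le.2 hcon
    have := Submodule.finrank_mono this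
    change dim c ≤ dim (b ⊓ c) at this
    omega
  have hle : linSpan b ≤ linSpan (b ⊓ c) ⊔ (ℝ ∙ p) := by
    refine Submodule.span_le.2 fun q hq => ?_
    have hseg : segment ℝ p q ⊆ (b : Set (RSpace n)) ∪ c :=
      hconv.segment_subset (Or.inr hpc) (Or.inl hq)
    have hpre := (convex_segment (𝕜 := ℝ) p q).isPreconnected
    obtain ⟨x, hx, hxb, hxc⟩ := (isPreconnected_closed_iff.1 hpre) b c
      (isClosed_of_isSimplicial hb) (isClosed_of_isSimplicial hc) hseg
      ⟨q, right_mem_segment _ _ _, hq⟩ ⟨p, left_mem_segment _ _ _, hpc⟩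
    have hxF : x ∈ linSpan (b ⊓ c) := Submodule.subset_span ⟨hxb, hxc⟩
    obtain ⟨s, t, -, -, hst, rfl⟩ := hx
    -- The crossing point `x = s p + t q` is not `p`, so `q` is a combination of `x` and `p`.
    have ht : t ≠ 0 := by
      rintro rfl
      obtain rfl : s = 1 := by simpa using hst
      exact hp (by simpa using hxF)
    have hq' : q = t⁻¹ • (s • p + t • q) + (-(t⁻¹ * s)) • p := by
      rw [smul_add, smul_smul, smul_smul, inv_mul_cancel₀ ht, one_smul, neg_smul]
      abel
    rw [SetLike.mem_coe, hq']
    exact Submodule.add_mem_sup (Submodule.smul_mem _ _ hxF)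
      (Submodule.smul_mem _ _ (Submodule.mem_span_singleton_self p))
  have h1 : dim b ≤ Module.finrank ℝ ↥(linSpan (b ⊓ c) ⊔ (ℝ ∙ p)) := Submodule.finrank_mono hle
  have h2 := Submodule.finrank_add_le_finrank_add_finrank (linSpan (b ⊓ c)) (ℝ ∙ p)
  have h3 : Module.finrank ℝ ↥(ℝ ∙ p) ≤ 1 := by
    simpa using finrank_span_le_card (R := ℝ) ({p} : Set (RSpace n))
  change _ ≤ dim (b ⊓ c) + _ at h2
  omega

/-- If two cones have points on the same open side of the span of a common subcone, then they share
a point on that side. -/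
lemma exists_mem_inf_inner_pos {w b c : PointedCone ℝ (RSpace n)} {u x y : RSpace n}
    (hwb : w ≤ b) (hwc : w ≤ c) (hu : (ℝ ∙ u)ᗮ ≤ linSpan w) (hu0 : ∀ v ∈ w, inner ℝ u v = 0)
    (hx : x ∈ b) (hy : y ∈ c) (hux : 0 < inner ℝ u x) (huy : 0 < inner ℝ u y) :
    ∃ z ∈ b ⊓ c, inner ℝ u z ≠ 0 := by
  set α := inner ℝ u x
  set β := inner ℝ u y
  have hmem : β • x - α • y ∈ linSpan w := by
    refine hu (Submodule.mem_orthogonal_singleton_iff_inner_right.2 ?_)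
    rw [inner_sub_right, inner_smul_right, inner_smul_right]
    change β * α - α * β = 0
    ring
  obtain ⟨s, hs, t, ht, hst⟩ := SimplicialFan.exists_sub_of_mem_linSpan w hmem
  have heq : β • x + t = α • y + s := by
    have : β • x = α • y + (s - t) := by rw [← hst]; abel
    rw [this]; abel
  refine ⟨β • x + t, ⟨b.add_mem (PointedCone.smul_mem b huy.le hx) (hwb ht), ?_⟩, ?_⟩
  · rw [heq]
    exact c.add_mem (PointedCone.smul_mem c hux.le hy) (hwc hs)
  · rw [inner_add_right, inner_smul_right, hu0 t ht, add_zero]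
    exact (mul_pos huy hux).ne'

/-- Two full-dimensional cones meeting in a common face, both with a given wall, and lying on the
same side of that wall, are equal. -/
lemma eq_of_same_side {w b c : PointedCone ℝ (RSpace n)} {u x y : RSpace n}
    (hdw : dim w + 1 = n) (hdb : dim b = n) (hdc : dim c = n)
    (hfb : IsFace (b ⊓ c) b) (hfc : IsFace (b ⊓ c) c) (hwb : w ≤ b) (hwc : w ≤ c)
    (hu : (ℝ ∙ u)ᗮ = linSpan w)
    (hx : x ∈ b) (hy : y ∈ c) (hux : 0 < inner ℝ u x) (huy : 0 < inner ℝ u y) : b = c := by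
  have hu0 : ∀ v ∈ w, inner ℝ u v = 0 := fun v hv =>
    Submodule.mem_orthogonal_singleton_iff_inner_right.1 (hu ▸ Submodule.subset_span hv)
  obtain ⟨z, hz, hz0⟩ := exists_mem_inf_inner_pos hwb hwc hu.le hu0 hx hy hux huy
  have hlt : linSpan w < linSpan (b ⊓ c) := by
    refine lt_of_le_of_ne (Submodule.span_mono (le_inf hwb hwc)) fun heq => hz0 ?_
    have : z ∈ linSpan w := heq ▸ Submodule.subset_span hz
    exact Submodule.mem_orthogonal_singleton_iff_inner_right.1 (hu ▸ this)
  have hd := Submodule.finrank_lt_finrank_of_lt hlt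
  change dim w < dim (b ⊓ c) at hd
  exact (hfb.eq_of_dim_le (by omega)).symm.trans (hfc.eq_of_dim_le (by omega))

/-- A normal vector of a wall takes a non-zero value at some point of a full-dimensional cone. -/
lemma exists_inner_ne_zero {b : PointedCone ℝ (RSpace n)} {u : RSpace n} (hu : u ≠ 0)
    (hdb : dim b = n) : ∃ x ∈ b, inner ℝ u x ≠ 0 := by
  by_contra! hcon
  have h1 := linSpan_le_of_inner_eq_zero hcon
  rw [linSpan_eq_top_of_dim hdb] at h1
  have h2 : u ∈ (ℝ ∙ u)ᗮ := h1 trivial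
  exact hu (inner_self_eq_zero.1 (Submodule.mem_orthogonal_singleton_iff_inner_right.1 h2))

/-- The span of a wall is the orthogonal complement of a line. -/
lemma exists_normal {w : PointedCone ℝ (RSpace n)} (hdw : dim w + 1 = n) :
    ∃ u : RSpace n, u ≠ 0 ∧ (ℝ ∙ u)ᗮ = linSpan w := by
  have h := Submodule.finrank_add_finrank_orthogonal (linSpan w)
  rw [finrank_euclideanSpace_fin] at h
  change dim w + _ = n at h
  have h1 : Module.finrank ℝ (linSpan w)ᗮ = 1 := by omega
  obtain ⟨⟨u, hu⟩, hu0, hspan⟩ := finrank_eq_one_iff'.1 h1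
  refine ⟨u, fun h0 => hu0 (Subtype.ext h0), ?_⟩
  have : (ℝ ∙ u) = (linSpan w)ᗮ := by
    refine le_antisymm ((Submodule.span_singleton_le_iff_mem _ _).2 hu) fun v hv => ?_
    obtain ⟨a, ha⟩ := hspan ⟨v, hv⟩
    exact Submodule.mem_span_singleton.2 ⟨a, congrArg Subtype.val ha⟩
  rw [this, Submodule.orthogonal_orthogonal]

end ConeGeometry

namespace SimplicialFan

variable {n : ℕ} {S : SimplicialFan n}

lemma MaxCone.eq_of_le {b : S.MaxCone} {τ : S.Cone} (h : b.1 ≤ τ) : b.1 = τ := by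
  have hf := (S.inter_face _ b.1.2 _ τ.2).2
  rw [inf_eq_left.2 (show b.1.1 ≤ τ.1 from h)] at hf
  exact Subtype.ext (hf.eq_of_dim_le ((dim_le _).trans b.2.ge))

/-- A wall lies in at most two maximal cones. -/
lemma Wall.eq_or_eq (w : S.Wall) {b c d : S.MaxCone} (hb : w.1 ≤ b.1) (hc : w.1 ≤ c.1)
    (hd : w.1 ≤ d.1) (hbc : b ≠ c) : d = b ∨ d = c := by
  obtain ⟨u, hu0, hu⟩ := exists_normal w.2
  have hu' : (ℝ ∙ (-u))ᗮ = linSpan w.1.1 := by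
    rw [← Set.neg_singleton, Submodule.span_neg, hu]
  have key : ∀ {p q : S.MaxCone}, w.1 ≤ p.1 → w.1 ≤ q.1 → ∀ v : RSpace n,
      (ℝ ∙ v)ᗮ = linSpan w.1.1 → ∀ x ∈ p.1.1, ∀ y ∈ q.1.1, 0 < inner ℝ v x → 0 < inner ℝ v y →
        p = q := by
    intro p q hp hq v hv x hx y hy hvx hvy
    refine Subtype.ext (Subtype.ext ?_)
    have hf := S.inter_face _ p.1.2 _ q.1.2
    exact eq_of_same_side w.2 p.2 q.2 hf.1 hf.2 hp hq hv hx hy hvx hvy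
  have key' : ∀ {p q : S.MaxCone}, w.1 ≤ p.1 → w.1 ≤ q.1 → ∀ x ∈ p.1.1, ∀ y ∈ q.1.1,
      inner ℝ u x < 0 → inner ℝ u y < 0 → p = q := by
    intro p q hp hq x hx y hy hux huy
    exact key hp hq (-u) hu' x hx y hy (by rw [inner_neg_left]; linarith)
      (by rw [inner_neg_left]; linarith)
  obtain ⟨x, hx, hx0⟩ := exists_inner_ne_zero hu0 b.2
  obtain ⟨y, hy, hy0⟩ := exists_inner_ne_zero hu0 c.2
  obtain ⟨z, hz, hz0⟩ := exists_inner_ne_zero hu0 d.2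
  rcases hx0.lt_or_gt with hx0 | hx0 <;> rcases hy0.lt_or_gt with hy0 | hy0
  · exact (hbc (key' hb hc x hx y hy hx0 hy0)).elim
  · rcases hz0.lt_or_gt with hz0 | hz0
    · exact Or.inl (key' hd hb z hz x hx hz0 hx0)
    · exact Or.inr (key hd hc u hu z hz y hy hz0 hy0)
  · rcases hz0.lt_or_gt with hz0 | hz0
    · exact Or.inr (key' hd hc z hz y hy hz0 hy0)
    · exact Or.inl (key hd hb u hu z hz x hx hz0 hx0)
  · exact (hbc (key hb hc u hu x hx y hy hx0 hy0)).elim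

end SimplicialFan

/-! ### Matching of facial intervals -/

namespace SimplicialFan

variable {n : ℕ} {S : SimplicialFan n}

/-- Cones `τ₁` in the star of `σ₁` and `τ₂` in the star of `σ₂` with the same projection. -/
structure Matched (σ₁ σ₂ τ₁ τ₂ : S.Cone) : Prop where
  left : σ₁ ≤ τ₁
  right : σ₂ ≤ τ₂
  image_eq : image σ₁ τ₁ = image σ₂ τ₂

namespace Matched

variable {P : S.AdmissiblePartition} {σ₁ σ₂ τ₁ τ₂ κ₁ κ₂ : S.Cone}

lemma symm (h : Matched σ₁ σ₂ τ₁ τ₂) : Matched σ₂ σ₁ τ₂ τ₁ :=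
  ⟨h.right, h.left, h.image_eq.symm⟩

/-- Matching is monotone. -/
lemma le_right (hτ : Matched σ₁ σ₂ τ₁ τ₂) (hκ : Matched σ₁ σ₂ κ₁ κ₂) (h : τ₁ ≤ κ₁) :
    τ₂ ≤ κ₂ := by
  refine le_of_image_subset hτ.right hκ.right ?_
  rw [← hτ.image_eq, ← hκ.image_eq]
  exact Set.image_mono h

lemma eq_right (hτ : Matched σ₁ σ₂ τ₁ τ₂) (hκ : Matched σ₁ σ₂ κ₁ κ₂) (h : τ₁ = κ₁) :
    τ₂ = κ₂ :=
  le_antisymm (hτ.le_right hκ h.le) (hκ.le_right hτ h.ge)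

lemma rel (hσ : P.r σ₁ σ₂) (h : Matched σ₁ σ₂ τ₁ τ₂) : P.r τ₁ τ₂ :=
  P.admissible _ _ _ _ hσ h.left h.right h.image_eq

lemma dim_eq (hσ : P.r σ₁ σ₂) (h : Matched σ₁ σ₂ τ₁ τ₂) : dim τ₁.1 = dim τ₂.1 := by
  have h1 := congrArg (fun K : Submodule ℝ (RSpace n) => Kᗮ) (P.potential _ _ (h.rel hσ)).1
  simp only [Submodule.orthogonal_orthogonal] at h1
  unfold dim
  rw [h1]

lemma exists_right (hσ : P.r σ₁ σ₂) (h : σ₁ ≤ τ₁) : ∃ τ₂, Matched σ₁ σ₂ τ₁ τ₂ := by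
  obtain ⟨τ₂, hle, him⟩ := P.exists_match hσ h
  exact ⟨τ₂, h, hle, him⟩

lemma exists_left (hσ : P.r σ₁ σ₂) (h : σ₂ ≤ τ₂) : ∃ τ₁, Matched σ₁ σ₂ τ₁ τ₂ := by
  obtain ⟨τ₁, hm⟩ := exists_right (P.symm hσ) h
  exact ⟨τ₁, hm.symm⟩

lemma exists_maxCone_right (hσ : P.r σ₁ σ₂) {b : S.MaxCone} (h : σ₁ ≤ b.1) :
    ∃ b' : S.MaxCone, Matched σ₁ σ₂ b.1 b'.1 := by
  obtain ⟨τ, hτ⟩ := exists_right hσ h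
  exact ⟨⟨τ, (hτ.dim_eq hσ).symm.trans b.2⟩, hτ⟩

lemma self (hσ : P.r σ₁ σ₂) : Matched σ₁ σ₂ σ₁ σ₂ := by
  obtain ⟨τ, hτ⟩ := exists_right hσ le_rfl
  obtain ⟨κ, hκ⟩ := exists_left hσ le_rfl
  rwa [le_antisymm (hτ.le_right hκ hκ.left) hτ.right] at hτ

/-- Matching respects intersections. -/
lemma inf_eq (hσ : P.r σ₁ σ₂) {w₁ w₂ : S.Cone} (hw : Matched σ₁ σ₂ w₁ w₂)
    (hτ : Matched σ₁ σ₂ τ₁ τ₂) (hκ : Matched σ₁ σ₂ κ₁ κ₂) (h : w₁.1 = τ₁.1 ⊓ κ₁.1) :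
    w₂.1 = τ₂.1 ⊓ κ₂.1 := by
  -- The intersection `m₂` is matched with some `m₁`, which lies below both `τ₁` and `κ₁`.
  let m₂ : S.Cone := ⟨τ₂.1 ⊓ κ₂.1, S.face_mem _ τ₂.2 _ (S.inter_face _ τ₂.2 _ κ₂.2).1⟩
  have hle : σ₂.1 ≤ τ₂.1 ⊓ κ₂.1 := le_inf hτ.right hκ.right
  obtain ⟨m₁, hm⟩ := exists_left (τ₂ := m₂) hσ hle
  have h1 : m₁ ≤ τ₁ := hm.symm.le_right hτ.symm (inf_le_left (a := τ₂.1))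
  have h2 : m₁ ≤ κ₁ := hm.symm.le_right hκ.symm (inf_le_right (b := κ₂.1))
  have h3 : m₁ ≤ w₁ := by
    change m₁.1 ≤ w₁.1
    rw [h]
    exact le_inf h1 h2
  have h4 : w₁ ≤ τ₁ := by
    change w₁.1 ≤ τ₁.1
    rw [h]
    exact inf_le_left
  have h5 : w₁ ≤ κ₁ := by
    change w₁.1 ≤ κ₁.1
    rw [h]
    exact inf_le_right
  exact le_antisymm (le_inf (hw.le_right hτ h4) (hw.le_right hκ h5)) (hm.le_right hw h3)

end Matched

section FanPoset

variable [PartialOrder S.MaxCone] {P : S.AdmissiblePartition}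

lemma ChainWord.le {a b : S.MaxCone} {w : List P.WallClass} (h : ChainWord P a b w) : a ≤ b := by
  induction h with
  | nil => exact le_rfl
  | cons σ hbc hσ hw ih => exact ih.trans hbc.le

lemma IsFanPoset.ordConnected_maxStar (hS : IsFanPoset S) (σ : S.Cone) :
    (maxStar σ).OrdConnected := by
  obtain ⟨a, b, -, h⟩ := hS.facial σ
  rw [h]
  exact Set.ordConnected_Icc

lemma IsFanPoset.low_maxCone (hS : IsFanPoset S) (b : S.MaxCone) : hS.low b.1 = b :=
  Subtype.ext (MaxCone.eq_of_le (hS.low_isLeast b.1).1).symm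

/-- In a fan poset, a maximal cone and one covering it meet in codimension one. -/
lemma IsFanPoset.exists_wall_of_covBy (hS : IsFanPoset S) {b c : S.MaxCone} (hbc : b ⋖ c) :
    ∃ w : S.Wall, w.1.1 = b.1.1 ⊓ c.1.1 := by
  have hf := S.inter_face _ b.1.2 _ c.1.2
  have hconv : Convex ℝ ((b.1.1 : Set (RSpace n)) ∪ c.1.1) := by
    obtain ⟨s, -, hs⟩ := hS.interval_cone b c hbc.le
    rw [hbc.Icc_eq, Set.biUnion_pair] at hs
    rw [hs]
    exact PointedCone.convex _
  have hne : b.1.1 ≠ c.1.1 := fun h => hbc.ne (Subtype.ext (Subtype.ext h))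
  exact ⟨⟨⟨_, S.face_mem _ b.1.2 _ hf.1⟩, dim_inf_of_convex_union (S.simplicial _ b.1.2)
    (S.simplicial _ c.1.2) b.2 c.2 hf.2 hf.1 hne hconv⟩, rfl⟩

lemma IsFanPoset.finite_maxCone (hS : IsFanPoset S) : Finite S.MaxCone := by
  have : Finite S.Cone := hS.finite
  exact Subtype.finite

/-- In a non-degenerate partitioned fan poset, matching preserves covering relations and their
labels. A wall is contained in at most two maximal cones, and these form an interval, so they are
comparable; if the order were reversed by the matching, the relation of the second type given by
`[f_{wc}] = [f_{w'c'}]` would read `X_{[w]} = e`. -/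
lemma IsFanPoset.covBy_of_matched (hS : IsFanPoset S) (hnd : NonDegenerate hS P)
    {σ₁ σ₂ : S.Cone} (hσ : P.r σ₁ σ₂) {b c b' c' : S.MaxCone} {w : S.Wall} (hbc : b ⋖ c)
    (hw : w.1.1 = b.1.1 ⊓ c.1.1) (hb : Matched σ₁ σ₂ b.1 b'.1) (hc : Matched σ₁ σ₂ c.1 c'.1) :
    ∃ w' : S.Wall, b' ⋖ c' ∧ w'.1.1 = b'.1.1 ⊓ c'.1.1 ∧ P.wallCls w' = P.wallCls w := by
  have hσw : σ₁ ≤ w.1 := by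
    change σ₁.1 ≤ w.1.1
    rw [hw]
    exact le_inf hb.left hc.left
  have hwb : w.1 ≤ b.1 := hw.le.trans inf_le_left
  have hwc : w.1 ≤ c.1 := hw.le.trans inf_le_right
  obtain ⟨τ, hτ⟩ := Matched.exists_right hσ hσw
  let w' : S.Wall := ⟨τ, (congrArg (· + 1) (hτ.dim_eq hσ)).symm.trans w.2⟩
  have hw'b : w'.1 ≤ b'.1 := hτ.le_right hb hwb
  have hw'c : w'.1 ≤ c'.1 := hτ.le_right hc hwc
  have hne : b' ≠ c' := fun h => hbc.ne <| Subtype.ext <|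
    hb.symm.eq_right hc.symm (congrArg Subtype.val h)
  refine ⟨w', ?_, hτ.inf_eq hσ hb hc hw, Quotient.sound (P.symm (hτ.rel hσ))⟩
  have hlow' := hS.low_isLeast w'.1
  rcases w'.eq_or_eq hw'b hw'c hlow'.1 hne with h | h
  · have hle : b' ≤ c' := h ▸ hlow'.2 hw'c
    refine ⟨lt_of_le_of_ne hle hne, fun d hbd hdc => ?_⟩
    have hd : d ∈ maxStar w'.1 :=
      (hS.ordConnected_maxStar w'.1).out hw'b hw'c ⟨hbd.le, hdc.le⟩
    rcases w'.eq_or_eq hw'b hw'c hd hne with h | h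
    · exact hbd.ne' h
    · exact hdc.ne h
  · exfalso
    -- Here `c'` is the minimum `w'⁻`, whereas `w⁻ = b`, so that the words of
    -- `[w⁻, c⁻] = [b, c]` and of `[w'⁻, c'⁻] = [c', c']` are `X_{[w]}` and the empty word.
    have hlow := hS.low_isLeast w.1
    have hlb : hS.low w.1 = b := by
      rcases w.eq_or_eq hwb hwc hlow.1 hbc.ne with h' | h'
      · exact h'
      · exact (hbc.lt.not_ge (h' ▸ hlow.2 hwb)).elim
    refine hnd w ⟨P.cls w.1, P.cls c.1, ⟨w.1, c.1, hwc, rfl, rfl⟩, ⟨w'.1, c'.1, hw'c,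
      (AdmissiblePartition.cls_eq.2 (hτ.rel hσ)).symm,
      (AdmissiblePartition.cls_eq.2 (hc.rel hσ)).symm⟩,
      AdmissiblePartition.PreHom.toHom_eq.2
        (P.image_eq hσ hτ.left hτ.right hτ.image_eq hc.image_eq), ?_, ?_⟩
    · change ChainWord P (hS.low w.1) (hS.low c.1) _
      rw [hlb, hS.low_maxCone]
      exact ChainWord.cons w hbc hw ChainWord.nil
    · change ChainWord P (hS.low w'.1) (hS.low c'.1) _
      rw [h, hS.low_maxCone]
      exact ChainWord.nil

/-- In a non-degenerate partitioned fan poset, matching carries maximal chains of an interval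
between cones of a star, with their labels, to maximal chains. -/
lemma IsFanPoset.chainWord_of_matched (hS : IsFanPoset S) (hnd : NonDegenerate hS P)
    {σ₁ σ₂ : S.Cone} (hσ : P.r σ₁ σ₂) {a b a' b' : S.MaxCone} {w : List P.WallClass}
    (h : ChainWord P a b w) (ha : Matched σ₁ σ₂ a.1 a'.1) (hb : Matched σ₁ σ₂ b.1 b'.1) :
    ChainWord P a' b' w := by
  induction h generalizing b' with
  | nil =>
    obtain rfl : a' = b' := Subtype.ext (ha.eq_right hb rfl)
    exact ChainWord.nil
  | @cons b c w σ hbc hσ' hw ih =>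
    have hb1 : b ∈ maxStar σ₁ :=
      (hS.ordConnected_maxStar σ₁).out ha.left hb.left ⟨hw.le, hbc.le⟩
    obtain ⟨d, hd⟩ := Matched.exists_maxCone_right hσ hb1
    obtain ⟨w', hcov, hw', hcls⟩ := hS.covBy_of_matched hnd hσ hbc hσ' hd hb
    rw [← hcls]
    exact ChainWord.cons w' hcov hw' (ih hd)

/-- In a non-degenerate partitioned fan poset, matching preserves the order on maximal cones, since
this order is generated by its covering relations. -/
lemma IsFanPoset.le_of_matched (hS : IsFanPoset S) (hnd : NonDegenerate hS P)
    {σ₁ σ₂ : S.Cone} (hσ : P.r σ₁ σ₂) {a b a' b' : S.MaxCone} (hab : a ≤ b)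
    (ha : Matched σ₁ σ₂ a.1 a'.1) (hb : Matched σ₁ σ₂ b.1 b'.1) : a' ≤ b' := by
  classical
  have := hS.finite_maxCone
  have := Fintype.ofFinite S.MaxCone
  let _ : LocallyFiniteOrder S.MaxCone := Fintype.toLocallyFiniteOrder
  have hgen := le_iff_reflTransGen_covBy.1 hab
  induction hgen generalizing b' with
  | refl =>
    obtain rfl : a' = b' := Subtype.ext (ha.eq_right hb rfl)
    exact le_rfl
  | @tail b c hab' hbc ih =>
    have hle := le_iff_reflTransGen_covBy.2 hab'
    have hb1 : b ∈ maxStar σ₁ :=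
      (hS.ordConnected_maxStar σ₁).out ha.left hb.left ⟨hle, hbc.le⟩
    obtain ⟨d, hd⟩ := Matched.exists_maxCone_right hσ hb1
    obtain ⟨w, hw⟩ := hS.exists_wall_of_covBy hbc
    obtain ⟨-, hcov, -⟩ := hS.covBy_of_matched hnd hσ hbc hw hd hb
    exact (ih hle hd).trans hcov.le

/-- Matching preserves the minima of facial intervals. -/
lemma IsFanPoset.matched_low (hS : IsFanPoset S) (hnd : NonDegenerate hS P)
    {σ₁ σ₂ κ₁ κ₂ : S.Cone} (hσ : P.r σ₁ σ₂) (hκ : Matched σ₁ σ₂ κ₁ κ₂) :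
    Matched σ₁ σ₂ (hS.low κ₁).1 (hS.low κ₂).1 := by
  have h₁ := hS.low_isLeast κ₁
  have h₂ := hS.low_isLeast κ₂
  obtain ⟨m₂, hm₂⟩ := Matched.exists_maxCone_right hσ (hκ.left.trans h₁.1)
  obtain ⟨m₁, hm₁⟩ := Matched.exists_maxCone_right (P.symm hσ) (hκ.right.trans h₂.1)
  have hle : hS.low κ₁ ≤ m₁ := h₁.2 (hκ.symm.le_right hm₁ h₂.1)
  have hge : hS.low κ₂ ≤ m₂ := h₂.2 (hκ.le_right hm₂ h₁.1)
  rwa [le_antisymm (hS.le_of_matched hnd hσ hle hm₂ hm₁.symm) hge] at hm₂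

/-- In a non-degenerate partitioned fan poset, the relations of the second type already are
relations of the first type: a maximal chain of `[σ₁⁻, κ₁⁻]` and its labels are carried by the
matching to a maximal chain of `[σ₂⁻, κ₂⁻]`. -/
lemma SecondRel.firstRel {hS : IsFanPoset S} (hnd : NonDegenerate hS P) {w w' : List P.WallClass}
    (h : SecondRel hS P w w') : FirstRel P w w' := by
  obtain ⟨X, Y, f, g, hfg, hw, hw'⟩ := h
  have hσ := f.rel_src g
  have hm : Matched f.src g.src f.tgt g.tgt :=
    ⟨f.le, g.le, AdmissiblePartition.PreHom.toHom_eq.1 hfg⟩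
  exact ⟨_, _, hS.chainWord_of_matched hnd hσ hw (hS.matched_low hnd hσ (Matched.self hσ))
    (hS.matched_low hnd hσ hm), hw'⟩

end FanPoset

end SimplicialFan

/-! ### The comparison of picture groups -/

namespace SimplicialFan

variable {n : ℕ} {S : SimplicialFan n} [PartialOrder S.MaxCone]

/-- The generator of the picture group indexed by a class of cones of codimension one. -/
def clsGen (hS : IsFanPoset S) (P : S.AdmissiblePartition) (x : P.WallClass) :
    PictureGroup hS P :=
  PresentedGroup.of (rels := pictureRels hS P) x

/-- The element of the picture group given by a word. -/
def pictureWord (hS : IsFanPoset S) (P : S.AdmissiblePartition) (w : List P.WallClass) :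
    PictureGroup hS P :=
  (w.map (clsGen hS P)).prod

lemma lift_wordElt {α G : Type} [Group G] (f : α → G) (w : List α) :
    FreeGroup.lift f (wordElt w) = (w.map f).prod := by
  rw [wordElt, map_list_prod, List.map_map]
  congr 2
  funext x
  exact FreeGroup.lift_apply_of

lemma pictureWord_eq {hS : IsFanPoset S} {P : S.AdmissiblePartition} {w w' : List P.WallClass}
    (h : FirstRel P w w' ∨ SecondRel hS P w w') : pictureWord hS P w = pictureWord hS P w' := by
  have key : ∀ v, pictureWord hS P v = PresentedGroup.mk (pictureRels hS P) (wordElt v) := by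
    intro v
    rw [wordElt, map_list_prod, List.map_map]
    rfl
  rw [key, key]
  exact PresentedGroup.mk_eq_mk_of_mul_inv_mem ⟨w, w', h, rfl⟩

section Refinement

variable {P₁ P₂ : S.AdmissiblePartition} (hfiner : ∀ σ τ : S.Cone, P₁.r σ τ → P₂.r σ τ)

/-- The map `[σ]_{P₁} ↦ [σ]_{P₂}` on classes of cones of codimension one. -/
def coarsenWall (x : P₁.WallClass) : P₂.WallClass :=
  Quotient.map' (s₁ := P₁.toSetoid.comap _) (s₂ := P₂.toSetoid.comap _) id
    (fun _ _ h => hfiner _ _ h) x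

lemma ChainWord.coarsen {a b : S.MaxCone} {w : List P₁.WallClass} (h : ChainWord P₁ a b w) :
    ChainWord P₂ a b (w.map (coarsenWall hfiner)) := by
  induction h with
  | nil => exact ChainWord.nil
  | cons σ hbc hσ hw ih => exact ChainWord.cons σ hbc hσ ih

lemma ChainWord.exists_refine {a b : S.MaxCone} {w : List P₂.WallClass}
    (h : ChainWord P₂ a b w) : ∃ v, ChainWord P₁ a b v ∧ v.map (coarsenWall hfiner) = w := by
  induction h with
  | nil => exact ⟨[], ChainWord.nil, rfl⟩
  | cons σ hbc hσ hw ih =>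
    obtain ⟨v, hv, rfl⟩ := ih
    exact ⟨P₁.wallCls σ :: v, ChainWord.cons σ hbc hσ hv, rfl⟩

lemma rel_coarsen {hS : IsFanPoset S} {w w' : List P₁.WallClass}
    (h : FirstRel P₁ w w' ∨ SecondRel hS P₁ w w') :
    FirstRel P₂ (w.map (coarsenWall hfiner)) (w'.map (coarsenWall hfiner)) ∨
      SecondRel hS P₂ (w.map (coarsenWall hfiner)) (w'.map (coarsenWall hfiner)) := by
  rcases h with ⟨a, b, hw, hw'⟩ | ⟨X, Y, f, g, hfg, hw, hw'⟩
  · exact Or.inl ⟨a, b, hw.coarsen hfiner, hw'.coarsen hfiner⟩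
  · have him := AdmissiblePartition.PreHom.toHom_eq.1 hfg
    exact Or.inr ⟨_, _, f.coarsen hfiner, g.coarsen hfiner,
      AdmissiblePartition.PreHom.toHom_eq.2 him, hw.coarsen hfiner, hw'.coarsen hfiner⟩

/-- The homomorphism of picture groups `X_{[σ]_{P₁}} ↦ X_{[σ]_{P₂}}`. -/
def coarsenHom (hS : IsFanPoset S) : PictureGroup hS P₁ →* PictureGroup hS P₂ :=
  PresentedGroup.toGroup (rels := pictureRels hS P₁)
    (f := fun x => clsGen hS P₂ (coarsenWall hfiner x)) (by
      rintro _ ⟨w, w', h, rfl⟩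
      rw [map_mul, map_inv, mul_inv_eq_one, lift_wordElt, lift_wordElt]
      have := pictureWord_eq (rel_coarsen hfiner h)
      unfold pictureWord at this
      rwa [List.map_map, List.map_map] at this)

lemma coarsenHom_gen (hS : IsFanPoset S) (σ : S.Wall) :
    coarsenHom hfiner hS (pictureGen hS P₁ σ) = pictureGen hS P₂ σ :=
  PresentedGroup.toGroup.of _

/-- The quotients `X_{[σ₁]} X_{[σ₂]}⁻¹` of generators of the picture group over `P₁` that get
identified over `P₂`. -/
def mergedGens (hS : IsFanPoset S) (P₁ P₂ : S.AdmissiblePartition) : Set (PictureGroup hS P₁) :=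
  {g | ∃ σ₁ σ₂ : S.Wall, P₁.wallCls σ₁ ≠ P₁.wallCls σ₂ ∧ P₂.wallCls σ₁ = P₂.wallCls σ₂ ∧
    g = pictureGen hS P₁ σ₁ * (pictureGen hS P₁ σ₂)⁻¹}

lemma mk_pictureGen_eq (hS : IsFanPoset S) {σ₁ σ₂ : S.Wall}
    (h : P₂.wallCls σ₁ = P₂.wallCls σ₂) :
    (QuotientGroup.mk (pictureGen hS P₁ σ₁) :
      PictureGroup hS P₁ ⧸ Subgroup.normalClosure (mergedGens hS P₁ P₂)) =
        QuotientGroup.mk (pictureGen hS P₁ σ₂) := by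
  by_cases h₁ : P₁.wallCls σ₁ = P₁.wallCls σ₂
  · unfold pictureGen
    rw [h₁]
  · refine (QuotientGroup.eq_iff_div_mem).2 ?_
    rw [div_eq_mul_inv]
    exact Subgroup.subset_normalClosure ⟨σ₁, σ₂, h₁, h, rfl⟩

/-- The map `[σ]_{P₂} ↦ X_{[σ]_{P₁}}` into the quotient of the picture group over `P₁`. -/
def refineGen (hS : IsFanPoset S) (P₁ P₂ : S.AdmissiblePartition) (x : P₂.WallClass) :
    PictureGroup hS P₁ ⧸ Subgroup.normalClosure (mergedGens hS P₁ P₂) :=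
  Quotient.lift (s := P₂.toSetoid.comap _) (fun σ => QuotientGroup.mk (pictureGen hS P₁ σ))
    (fun _ _ h => mk_pictureGen_eq hS (Quotient.sound h)) x

lemma refineGen_coarsenWall (hS : IsFanPoset S) (x : P₁.WallClass) :
    refineGen hS P₁ P₂ (coarsenWall hfiner x) =
      QuotientGroup.mk (clsGen hS P₁ x) := by
  obtain ⟨σ, rfl⟩ := Quotient.exists_rep x
  rfl

lemma prod_refineGen (hS : IsFanPoset S) (v : List P₁.WallClass) :
    ((v.map (coarsenWall hfiner)).map (refineGen hS P₁ P₂)).prod =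
      QuotientGroup.mk' (Subgroup.normalClosure (mergedGens hS P₁ P₂))
        (pictureWord hS P₁ v) := by
  unfold pictureWord
  rw [map_list_prod, List.map_map, List.map_map]
  congr 2
  funext x
  exact refineGen_coarsenWall hfiner hS x

lemma lift_refineGen_eq_one (hfiner : ∀ σ τ : S.Cone, P₁.r σ τ → P₂.r σ τ)
    (hS : IsFanPoset S) (hnd : NonDegenerate hS P₂) :
    ∀ r ∈ pictureRels hS P₂, FreeGroup.lift (refineGen hS P₁ P₂) r = 1 := by
  rintro _ ⟨w, w', h, rfl⟩
  rw [map_mul, map_inv, mul_inv_eq_one, lift_wordElt, lift_wordElt]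
  obtain ⟨a, b, hw, hw'⟩ : FirstRel P₂ w w' := h.elim id (SecondRel.firstRel hnd)
  obtain ⟨v, hv, rfl⟩ := hw.exists_refine hfiner
  obtain ⟨v', hv', rfl⟩ := hw'.exists_refine hfiner
  rw [prod_refineGen, prod_refineGen, pictureWord_eq (Or.inl ⟨a, b, hv, hv'⟩)]

/-- The picture group over `P₂` is the quotient of the picture group over `P₁` by the merged
generators. Non-degeneracy over `P₂` makes the relations of the second type over `P₂`, which involve
cones that need not be equivalent over `P₁`, consequences of those of the first type. -/
theorem exists_pictureGroup_quotient_equiv (hfiner : ∀ σ τ : S.Cone, P₁.r σ τ → P₂.r σ τ)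
    (hS : IsFanPoset S) (hnd : NonDegenerate hS P₂) :
    ∃ e : PictureGroup hS P₁ ⧸ Subgroup.normalClosure (mergedGens hS P₁ P₂) ≃*
        PictureGroup hS P₂,
      ∀ σ : S.Wall, e (QuotientGroup.mk (pictureGen hS P₁ σ)) = pictureGen hS P₂ σ := by
  have hker : Subgroup.normalClosure (mergedGens hS P₁ P₂) ≤ (coarsenHom hfiner hS).ker := by
    refine Subgroup.normalClosure_le_normal ?_
    rintro _ ⟨σ₁, σ₂, -, h, rfl⟩
    rw [SetLike.mem_coe, MonoidHom.mem_ker, map_mul, map_inv, mul_inv_eq_one, coarsenHom_gen,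
      coarsenHom_gen]
    unfold pictureGen
    rw [h]
  let φ := QuotientGroup.lift _ (coarsenHom hfiner hS) hker
  let ψ : PictureGroup hS P₂ →* _ :=
    PresentedGroup.toGroup (lift_refineGen_eq_one hfiner hS hnd)
  have hφ : ∀ σ, φ (QuotientGroup.mk (pictureGen hS P₁ σ)) = pictureGen hS P₂ σ :=
    coarsenHom_gen hfiner hS
  have hψ : ∀ σ, ψ (pictureGen hS P₂ σ) = QuotientGroup.mk (pictureGen hS P₁ σ) := fun σ =>
    PresentedGroup.toGroup.of _
  refine ⟨MonoidHom.toMulEquiv φ ψ ?_ ?_, hφ⟩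
  · refine QuotientGroup.monoidHom_ext _ (PresentedGroup.ext fun x => ?_)
    obtain ⟨σ, rfl⟩ := Quotient.exists_rep x
    exact (congrArg ψ (hφ σ)).trans (hψ σ)
  · refine PresentedGroup.ext fun x => ?_
    obtain ⟨σ, rfl⟩ := Quotient.exists_rep x
    exact (congrArg φ (hψ σ)).trans (hφ σ)

end Refinement

end SimplicialFan

theorem mainTheorem5 {n : ℕ} (S : SimplicialFan n) [PartialOrder S.MaxCone]
    (hS : SimplicialFan.IsFanPoset S) (P₁ P₂ : S.AdmissiblePartition)
    (hfiner : ∀ σ τ : S.Cone, P₁.r σ τ → P₂.r σ τ) :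
    (∃ F : P₁.Cat ⥤ P₂.Cat,
      F.Faithful ∧ Function.Surjective F.obj ∧ (∀ σ : S.Cone, F.obj (P₁.cls σ) = P₂.cls σ) ∧
      ∃ h : Quot (SimplicialFan.AdmissiblePartition.CellIdent P₁ P₂) ≃ₜ ClassifyingSpace P₂.Cat,
        ∀ x, h (Quot.mk _ x) = classifyingMap F x) ∧
    (SimplicialFan.NonDegenerate hS P₂ →
      ∃ e : SimplicialFan.PictureGroup hS P₁ ⧸ Subgroup.normalClosure
            {g : SimplicialFan.PictureGroup hS P₁ | ∃ σ₁ σ₂ : S.Wall,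
              P₁.wallCls σ₁ ≠ P₁.wallCls σ₂ ∧ P₂.wallCls σ₁ = P₂.wallCls σ₂ ∧
              g = SimplicialFan.pictureGen hS P₁ σ₁ * (SimplicialFan.pictureGen hS P₁ σ₂)⁻¹}
          ≃* SimplicialFan.PictureGroup hS P₂,
        ∀ σ : S.Wall, e (QuotientGroup.mk (SimplicialFan.pictureGen hS P₁ σ)) =
          SimplicialFan.pictureGen hS P₂ σ) := by
  refine ⟨⟨SimplicialFan.AdmissiblePartition.coarsen hfiner,
    SimplicialFan.AdmissiblePartition.coarsen_faithful hfiner,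
    SimplicialFan.AdmissiblePartition.coarsen_obj_surjective hfiner, fun σ => rfl,
    SimplicialFan.AdmissiblePartition.exists_homeomorph_quot_cellIdent hfiner⟩, fun hnd =>
    SimplicialFan.exists_pictureGroup_quotient_equiv hfiner hS hnd⟩
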